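/- Let $n\ge 0$ and let $g:\mathbb{R}^n\to[0,\infty)$ be log-concave (that is, $g((1-\lambda)x+\lambda y)\ge g(x)^{1-\lambda}g(y)^{\lambda}$ for $\lambda\in(0,1)$ whenever $g(x)g(y)>0$) and upper semicontinuous, with $0<\int_{\mathbb{R}^n} g<\infty$, with $\max g=g(o)$, and with the origin $o$ in the interior of $\mathrm{supp}(g)=\overline{\{x: g(x)>0\}}$. For $p\in(-1,\infty)$ put $\|o\|_{K_p(g)}=0$ and, for $x\neq o$, $$ \|x\|_{K_p(g)}=\begin{cases} \left(\frac{p}{g(o)}\int_0^\infty g(rx)\,r^{p-1}\,dr\right)^{-1/p}, & p>0,\\[2mm] \exp\left(-\frac{1}{g(o)}\int_{(0,\infty)}\log r\; d\mu_x(r)\right), & p=0,\\[2mm] \left(\frac{p}{g(o)}\int_0^\infty r^{p-1}\,(g(rx)-g(o))\,dr\right)^{-1/p}, & p\in(-1,0), \end{cases} $$ where $\mu_x=-d_r\,g(rx)$ is the Lebesgue–Stieltjes measure of the non-increasing function $r\mapsto g(rx)$ on $[0,\infty)$. Let $K_p(g)=\{x:\|x\|_{K_p(g)}\le 1\}$ be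 the $p$th Ball body of $g$. Then the following hold. (1) For every real $p>-1$, the integrals above converge absolutely for all $x\ne o$ and $0<\|x\|_{K_p(g)}<\infty$. The function $\|\cdot\|_{K_p(g)}$ is a gauge, i.e. a finite, non-negative, positively $1$-homogeneous convex function on $\mathbb{R}^n$. Equivalently, $K_p(g)$ is a convex body (a compact convex set with non-empty interior); moreover it contains $o$ in its interior, and its Minkowski functional $x\mapsto\inf\{t>0: x\in tK_p(g)\}$ is $\|\cdot\|_{K_p(g)}$. (2) For $p=0$ and every $x\ne o$ such that $r\mapsto g(rx)$ is continuous on $(0,\infty)$, one has $\|x\|_{K_0(g)}=\exp\left(-\frac1{g(o)}\int_0^\infty\left(-\frac{\partial}{\partial r}g(rx)\right)\log r\,dr\right)$, where $\frac{\partial}{\partial r}$ is the right derivative and the integral converges absolutely. (3) For $p=\infty$, the (possibly unbounded) set $K_\infty(g)=\mathrm{supp}(g)$ is closed and convex, and its Minkowski functional is a gauge. -/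

import Mathlib

open Set MeasureTheory

noncomputable section

/-- Log-concavity of a (non-negative) function: for `λ ∈ (0,1)` and `x, y` with `f x * f y > 0`,
`f ((1-λ) x + λ y) ≥ f x ^ (1-λ) * f y ^ λ`. -/
def IsLogConcave {n : ℕ} (f : EuclideanSpace ℝ (Fin n) → ℝ) : Prop :=
  ∀ l : ℝ, 0 < l → l < 1 → ∀ x y : EuclideanSpace ℝ (Fin n), 0 < f x * f y →
    f x ^ (1 - l) * f y ^ l ≤ f ((1 - l) • x + l • y)

/-- The class `LC_n`: non-negative, log-concave, upper semicontinuous functions on `ℝⁿ` with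
`0 < ∫ f < ∞`. -/
structure IsLC {n : ℕ} (f : EuclideanSpace ℝ (Fin n) → ℝ) : Prop where
  nonneg : ∀ x, 0 ≤ f x
  logConcave : IsLogConcave f
  upperSemicontinuous : UpperSemicontinuous f
  integrable : Integrable f volume
  integral_pos : 0 < ∫ x, f x

/-- The (closed) support `closure {x | g x > 0}`. -/
def supp {n : ℕ} (g : EuclideanSpace ℝ (Fin n) → ℝ) : Set (EuclideanSpace ℝ (Fin n)) :=
  closure {x | 0 < g x}

/-- The class `LC_n^0`: members of `LC_n` whose maximum is attained at the origin, the origin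
being an interior point of the support. -/
structure IsLC0 {n : ℕ} (g : EuclideanSpace ℝ (Fin n) → ℝ) : Prop extends IsLC g where
  le_origin : ∀ x, g x ≤ g 0
  origin_mem : (0 : EuclideanSpace ℝ (Fin n)) ∈ interior (supp g)

/-- A function in `LC_n^0` is non-increasing along every ray from the origin (the ray is extended
to negative parameters by the constant `g 0`). -/
theorem IsLC0.monotone_neg_ray {n : ℕ} {g : EuclideanSpace ℝ (Fin n) → ℝ} (hg : IsLC0 g)
    (x : EuclideanSpace ℝ (Fin n)) : Monotone (fun r : ℝ => -g (max r 0 • x)) := by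
  have key : ∀ s t : ℝ, 0 ≤ s → s ≤ t → g (t • x) ≤ g (s • x) := by
    intro s t hs hst
    rcases hs.eq_or_lt with rfl | hs
    · simpa using hg.le_origin (t • x)
    rcases hst.eq_or_lt with rfl | hst
    · exact le_rfl
    rcases (hg.nonneg (t • x)).eq_or_lt with h0 | hpos
    · rw [← h0]
      exact hg.nonneg _
    have ht : 0 < t := hs.trans hst
    have h00 : g (t • x) ≤ g 0 := hg.le_origin _
    have hl1 : s / t < 1 := (div_lt_one ht).2 hst
    have h := hg.logConcave (s / t) (div_pos hs ht) hl1 0 (t • x)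
      (mul_pos (hpos.trans_le h00) hpos)
    have e : (1 - s / t) • (0 : EuclideanSpace ℝ (Fin n)) + (s / t) • t • x = s • x := by
      rw [smul_zero, zero_add, smul_smul, div_mul_cancel₀ _ ht.ne']
    rw [e] at h
    refine le_trans ?_ h
    calc g (t • x) = g (t • x) ^ (1 - s / t) * g (t • x) ^ (s / t) := by
          rw [← Real.rpow_add hpos]; simp
      _ ≤ g 0 ^ (1 - s / t) * g (t • x) ^ (s / t) := by
          gcongr
  intro a b hab
  exact neg_le_neg (key _ _ (le_max_right _ _) (max_le_max_right 0 hab))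

open Classical in
/-- The Lebesgue-Stieltjes measure `-d_r g(rx)` of the non-increasing function `r ↦ g(rx)`,
`r ≥ 0`, i.e. the measure with mass `g((a+)x) - g((b+)x)` on `(a, b]` for `0 ≤ a ≤ b`. It is
`-∂_r g(rx) dr` where `r ↦ g(rx)` is locally absolutely continuous, and it has an atom where the
ray leaves the support of `g` if `g` jumps to zero there. By `IsLC0.monotone_neg_ray` the second
branch is never used for functions in `LC_n^0`. -/
def rayDecay {n : ℕ} (g : EuclideanSpace ℝ (Fin n) → ℝ) (x : EuclideanSpace ℝ (Fin n)) :
    Measure ℝ :=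
  if h : Monotone (fun r : ℝ => -g (max r 0 • x)) then h.stieltjesFunction.measure else 0

open Classical in
/-- The functional `‖x‖_{K_p(g)}` for real `p > -1`. Its value at the origin is `0`, as it is
for the Minkowski functional of every set that contains the origin. -/
def ballFunctional {n : ℕ} (p : ℝ) (g : EuclideanSpace ℝ (Fin n) → ℝ)
    (x : EuclideanSpace ℝ (Fin n)) : ℝ :=
  if x = 0 then 0
  else if 0 < p then
    (p / g 0 * ∫ r in Ioi (0 : ℝ), g (r • x) * r ^ (p - 1)) ^ (-1 / p)
  else if p = 0 then
    Real.exp (-(1 / g 0) * ∫ r in Ioi (0 : ℝ), Real.log r ∂(rayDecay g x))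
  else
    (p / g 0 * ∫ r in Ioi (0 : ℝ), r ^ (p - 1) * (g (r • x) - g 0)) ^ (-1 / p)

/-- The integral in the formula for `‖x‖_{K_p(g)}` converges (absolutely). -/
def BallIntegralConverges {n : ℕ} (p : ℝ) (g : EuclideanSpace ℝ (Fin n) → ℝ)
    (x : EuclideanSpace ℝ (Fin n)) : Prop :=
  (0 < p → IntegrableOn (fun r : ℝ => g (r • x) * r ^ (p - 1)) (Ioi 0)) ∧
  (p = 0 → IntegrableOn Real.log (Ioi 0) (rayDecay g x)) ∧
  (p < 0 → IntegrableOn (fun r : ℝ => r ^ (p - 1) * (g (r • x) - g 0)) (Ioi 0))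

/-- The `p`th Ball body `K_p(g)`, the unit ball of `‖·‖_{K_p(g)}`. -/
def ballBody {n : ℕ} (p : ℝ) (g : EuclideanSpace ℝ (Fin n) → ℝ) :
    Set (EuclideanSpace ℝ (Fin n)) :=
  {x | ballFunctional p g x ≤ 1}

/-- A convex body: a compact convex set with non-empty interior. -/
def IsConvexBody {n : ℕ} (K : Set (EuclideanSpace ℝ (Fin n))) : Prop :=
  Convex ℝ K ∧ IsCompact K ∧ (interior K).Nonempty

/-- A (finite) gauge: a non-negative, positively 1-homogeneous, convex function on `ℝⁿ`. -/
def IsGauge {n : ℕ} (N : EuclideanSpace ℝ (Fin n) → ℝ) : Prop :=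
  (∀ x, 0 ≤ N x) ∧ (∀ t : ℝ, 0 ≤ t → ∀ x, N (t • x) = t * N x) ∧ ConvexOn ℝ univ N

end

/-! Homogeneity of `‖·‖_{K_p(g)}` is a change of variables, so the content is convexity. A positive
1-homogeneous function is convex once it is quasi-convex on segments from `x` to `x + v` with `x, v`
independent (`isGauge_of_quasiconvex`). For `p ≠ 0` the functional is `(p M)^(-1/p)`, where `M` is
the `rayMoment` of `g / g 0`; this decreases in `M` for either sign of `p`. So it suffices that `M`
is quasi-concave on such segments.

Let first `f = exp(-φ)` with `φ` smooth and uniformly convex. Then `H(y) = M(x + y v)` has `H'' < 0`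
wherever `H' = 0`, hence no interior minimum. With `z = x + y v`, `S(r) = φ(r z)` and `k(r) = ∂_v
φ(r z)`, the condition `H' = 0` reads `∫ r^p e^{-S} k = 0`, while `H'' < 0` reads `∫ r^(p+1) e^{-S}
k² < ∫ r^(p+1) e^{-S} D²φ(r z)(v, v)`. This Brascamp-Lieb type inequality is
`weighted_hessian_integral_pos`: a function `B` vanishing at `0` and at infinity has derivative at
most the difference of the integrands minus a positive term. The discarded remainder is `1 + p`
times squares, so `p > -1` gives it the right sign.

For general `g`, `-log (g / g 0)` is approximated by a Lipschitz inf-convolution, then truncated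
near the origin, mollified, and made uniformly convex by adding `‖z‖²/k`. All approximants share a
linear bound at the origin and an exponential decay rate (`HasRadialControl`), so their moments
converge by dominated convergence. For `g` itself these bounds come from local Lipschitz continuity
of the convex function `-log g` and from boundedness of a superlevel set of finite volume.

For `p = 0`, the layer-cake formula turns `g 0 * p * M` with `p > 0` into `∫ r^p dμ_x`, the moment
generating function of `log r` under `μ_x`. Differentiating its logarithm at `0` shows that
`‖x‖_{K_0(g)}` is the limit of `‖x‖_{K_p(g)}` as `p` decreases to `0`, and gauges are closed under
pointwise limits. Where `g` is continuous on a ray, the fundamental theorem of calculus for right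
derivatives identifies `μ_x`. -/

open Filter Topology
open scoped Pointwise

/-! ### A weighted one-dimensional inequality of Brascamp-Lieb type. -/

/-- The differentiated function is the boundary term `B` of the weighted inequality. Its derivative
splits into an expression that the Hessian bound controls for every `ξ`, and a remainder that is `1
+ p` times a sum of squares with positive weights. -/
theorem HasDerivAt.weighted_remainder {p r : ℝ} (hr : 0 < r) {S S1 k Ψ : ℝ → ℝ} {S2 k1 : ℝ}
    (hS : HasDerivAt S (S1 r) r) (hS1 : HasDerivAt S1 S2 r) (hk : HasDerivAt k k1 r)
    (hS1pos : 0 < S1 r) (hΨ : HasDerivAt Ψ (r ^ p * Real.exp (-S r) * k r) r) :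
    ∃ ξ : ℝ, HasDerivAt (fun r => r ^ (p + 1) * Real.exp (-S r) *
        (k r - (1 + p) * (Ψ r * Real.exp (S r) * r ^ (-(p + 1)))) ^ 2 / S1 r
        - (1 + p) * (r ^ (-p) * Real.exp (S r) * Ψ r ^ 2))
      (r ^ (p + 1) * Real.exp (-S r) * (2 * ξ * k1 - ξ ^ 2 * S2 - k r ^ 2)
        - (1 + p) * (r ^ (p + 1) * Real.exp (-S r) *
          ((Ψ r * Real.exp (S r) * r ^ (-(p + 1))) ^ 2 +
            (ξ * S1 r + r * (Ψ r * Real.exp (S r) * r ^ (-(p + 1))) * S1 r) ^ 2 / (r * S1 r)))) r := by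
  -- This `ξ` is forced: with `N = k - (1 + p) χ`, the derivative of `N² / S1` is `2 (N / S1) N' -
  -- (N / S1)² S2`.
  refine ⟨(k r - (1 + p) * (Ψ r * Real.exp (S r) * r ^ (-(p + 1)))) / S1 r, ?_⟩
  have hE : HasDerivAt (fun r => Real.exp (S r)) (Real.exp (S r) * S1 r) r := hS.exp
  have hE' : HasDerivAt (fun r => Real.exp (-S r)) (Real.exp (-S r) * (-S1 r)) r := hS.fun_neg.exp
  have h1 : HasDerivAt (fun r : ℝ => r ^ (p + 1)) ((p + 1) * r ^ (p + 1 - 1)) r :=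
    Real.hasDerivAt_rpow_const (Or.inl hr.ne')
  have h2 : HasDerivAt (fun r : ℝ => r ^ (-(p + 1))) (-(p + 1) * r ^ (-(p + 1) - 1)) r :=
    Real.hasDerivAt_rpow_const (Or.inl hr.ne')
  have h3 : HasDerivAt (fun r : ℝ => r ^ (-p)) (-p * r ^ (-p - 1)) r :=
    Real.hasDerivAt_rpow_const (Or.inl hr.ne')
  have key := ((((h1.mul hE').mul ((hk.sub (((hΨ.mul hE).mul h2).const_mul (1 + p))).pow 2)).div
    hS1 hS1pos.ne').sub (((h3.mul hE).mul (hΨ.pow 2)).const_mul (1 + p)))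
  refine key.congr_deriv ?_
  have e1 : r ^ (p + 1) = r ^ p * r := by rw [Real.rpow_add hr, Real.rpow_one]
  have e2 : r ^ (-(p + 1)) = (r ^ p * r)⁻¹ := by rw [Real.rpow_neg hr.le, e1]
  have e3 : r ^ (-(p + 1) - 1) = (r ^ p * r * r)⁻¹ := by
    rw [Real.rpow_sub hr, e2, Real.rpow_one, mul_inv (r ^ p * r), div_eq_mul_inv]
  have e4 : r ^ (-p) = (r ^ p)⁻¹ := Real.rpow_neg hr.le _
  have e5 : r ^ (-p - 1) = (r ^ p * r)⁻¹ := by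
    rw [Real.rpow_sub hr, e4, Real.rpow_one, mul_inv, div_eq_mul_inv]
  have e6 : r ^ (p + 1 - 1) = r ^ p := by rw [add_sub_cancel_right]
  have hrp : r ^ p ≠ 0 := (Real.rpow_pos_of_pos hr _).ne'
  simp only [Pi.mul_apply, Pi.sub_apply, Pi.pow_apply, e1, e2, e3, e4, e5, e6, Real.exp_neg,
    Nat.add_one_sub_one, pow_one, Nat.cast_ofNat]
  have hEE : Real.exp (S r) ≠ 0 := (Real.exp_pos _).ne'
  generalize Real.exp (S r) = E at *
  generalize r ^ p = R at *
  generalize Ψ r = P at *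
  generalize k r = K at *
  generalize S1 r = s at *
  have hr' := hr.ne'
  have hs' := hS1pos.ne'
  field_simp
  ring

theorem tendsto_setIntegral_Ioi_atTop_zero {f : ℝ → ℝ} {a : ℝ} (hf : IntegrableOn f (Ioi a)) :
    Tendsto (fun r => ∫ u in Ioi r, f u) atTop (𝓝 0) := by
  have h := intervalIntegral_tendsto_integral_Ioi a hf tendsto_id
  have h2 : Tendsto (fun r => (∫ u in Ioi a, f u) - ∫ u in a..r, f u) atTop (𝓝 0) := by
    simpa using h.const_sub (∫ u in Ioi a, f u)
  refine h2.congr' ?_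
  filter_upwards [eventually_ge_atTop a] with r hr
  rw [← intervalIntegral.integral_Ioi_sub_Ioi hf hr]
  ring

/-- One-dimensional core of the convexity of Ball bodies: a weighted Brascamp-Lieb type
inequality along a ray. -/
theorem weighted_hessian_integral_pos {p ε L c : ℝ} (hp : -1 < p) (hε : 0 < ε) (hc : 0 < c)
    {S S1 S2 k k1 Q : ℝ → ℝ}
    (hS : ∀ r, HasDerivAt S (S1 r) r) (hS1 : ∀ r, HasDerivAt S1 (S2 r) r)
    (hk : ∀ r, HasDerivAt k (k1 r) r) (hS0 : ∀ r, 0 < r → ε * r ^ 2 ≤ S r)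
    (hS1pos : ∀ r, 0 < r → ε * r ≤ S1 r) (hkL : ∀ r, 0 < r → |k r| ≤ L * r)
    (hQ : Continuous Q) (hQL : ∀ r, |Q r| ≤ L)
    (hess : ∀ r, 0 < r → ∀ ξ, c ≤ Q r - 2 * ξ * k1 r + ξ ^ 2 * S2 r)
    (hzero : ∫ r in Ioi (0 : ℝ), r ^ p * Real.exp (-S r) * k r = 0) :
    0 < ∫ r in Ioi (0 : ℝ), r ^ (p + 1) * Real.exp (-S r) * (Q r - k r ^ 2) := by
  have hScont : Continuous S := continuous_iff_continuousAt.2 fun r => (hS r).continuousAt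
  have hkcont : Continuous k := continuous_iff_continuousAt.2 fun r => (hk r).continuousAt
  have hL : 0 ≤ L := (abs_nonneg _).trans (hQL 0)
  set w : ℝ → ℝ := fun r => r ^ p * Real.exp (-S r) * k r with hw
  have hrpow : ∀ s : ℝ, ContinuousOn (fun r : ℝ => r ^ s) (Ioi 0) := fun s r hr =>
    (Real.continuousAt_rpow_const _ _ (Or.inl (ne_of_gt hr))).continuousWithinAt
  have hexpc : Continuous fun r => Real.exp (-S r) := Real.continuous_exp.comp hScont.neg
  have hwc : ContinuousOn w (Ioi 0) :=
    ((hrpow p).mul hexpc.continuousOn).mul hkcont.continuousOn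
  have hgauss : ∀ s : ℝ, -1 < s → ∀ b : ℝ, 0 < b →
      IntegrableOn (fun r : ℝ => r ^ s * Real.exp (-b * r ^ 2)) (Ioi 0) := fun s hs b hb =>
    integrableOn_rpow_mul_exp_neg_mul_sq hb hs
  have hexple : ∀ r, 0 < r → Real.exp (-S r) ≤ Real.exp (-ε * r ^ 2) := fun r hr =>
    Real.exp_le_exp.2 (by linarith [hS0 r hr])
  have hwle : ∀ r, 0 < r → |w r| ≤ L * (r ^ (p + 1) * Real.exp (-S r)) := by
    intro r hr
    have h1 : 0 < r ^ p := Real.rpow_pos_of_pos hr _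
    rw [hw]
    simp only [abs_mul, abs_of_pos h1, Real.abs_exp]
    rw [Real.rpow_add hr, Real.rpow_one]
    have := mul_le_mul_of_nonneg_left (hkL r hr) (mul_pos h1 (Real.exp_pos (-S r))).le
    linarith
  have hwint : IntegrableOn w (Ioi 0) := by
    refine ((hgauss (p + 1) (by linarith) ε hε).const_mul L).mono'
      (hwc.aestronglyMeasurable measurableSet_Ioi) ?_
    refine (ae_restrict_iff' measurableSet_Ioi).2 (ae_of_all _ fun r hr => ?_)
    refine (hwle r hr).trans ?_
    have := hexple r hr
    have h1 : 0 < r ^ (p + 1) := Real.rpow_pos_of_pos hr _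
    gcongr
  -- The primitive of `w` vanishes at `0` by definition and at infinity by `hzero`; this makes both
  -- boundary terms disappear.
  set Ψ : ℝ → ℝ := fun r => ∫ u in (0 : ℝ)..r, w u with hΨ
  have hΨd : ∀ r, 0 < r → HasDerivAt Ψ (w r) r := by
    intro r hr
    refine intervalIntegral.integral_hasDerivAt_right ?_ ?_ (hwc.continuousAt (Ioi_mem_nhds hr))
    · rw [intervalIntegrable_iff_integrableOn_Ioc_of_le hr.le]
      exact hwint.mono_set Ioc_subset_Ioi_self
    · exact hwc.stronglyMeasurableAtFilter isOpen_Ioi r hr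
  have hSmono : ∀ r u, 0 < r → r ≤ u → S r ≤ S u := by
    intro r u hr hru
    have : MonotoneOn S (Ici r) := by
      refine monotoneOn_of_deriv_nonneg (convex_Ici r) hScont.continuousOn
        (fun x _ => (hS x).differentiableAt.differentiableWithinAt) ?_
      intro x hx
      rw [interior_Ici] at hx
      have hx' : 0 < x := hr.trans hx
      rw [(hS x).deriv]
      exact (mul_pos hε hx').le.trans (hS1pos x hx')
    exact this self_mem_Ici hru hru
  have hΨ0 : ∀ r, 0 < r → |Ψ r| ≤ L * r ^ (p + 2) := by
    intro r hr
    have hb : ∀ u ∈ Set.uIoc 0 r, ‖w u‖ ≤ L * r ^ (p + 1) := by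
      intro u hu
      rw [uIoc_of_le hr.le] at hu
      refine (hwle u hu.1).trans ?_
      have h2 : u ^ (p + 1) ≤ r ^ (p + 1) := Real.rpow_le_rpow hu.1.le hu.2 (by linarith)
      have h3 : Real.exp (-S u) ≤ 1 := by
        rw [Real.exp_le_one_iff]
        have := hS0 u hu.1
        have : 0 ≤ ε * u ^ 2 := by positivity
        linarith
      have h4 : 0 < r ^ (p + 1) := Real.rpow_pos_of_pos hr _
      calc L * (u ^ (p + 1) * Real.exp (-S u)) ≤ L * (r ^ (p + 1) * 1) := by gcongr
        _ = _ := by ring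
    have := intervalIntegral.norm_integral_le_of_norm_le_const hb
    rw [sub_zero, abs_of_pos hr] at this
    refine (this.trans_eq ?_)
    rw [show p + 2 = p + 1 + 1 by ring, Real.rpow_add hr (p + 1), Real.rpow_one]
    ring
  -- Half of the Gaussian rate is kept under the integral. The other half is pulled out as
  -- `e^{-S(r)/2}` by monotonicity of `S`, so that `e^S Ψ² ≤ T²`.
  set T : ℝ → ℝ := fun r => ∫ u in Ioi r, L * (u ^ (p + 1) * Real.exp (-(ε / 2) * u ^ 2)) with hT
  have hTint : IntegrableOn (fun u : ℝ => L * (u ^ (p + 1) * Real.exp (-(ε / 2) * u ^ 2))) (Ioi 0) :=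
    (hgauss (p + 1) (by linarith) (ε / 2) (by linarith)).const_mul L
  have hT0 : ∀ r, 0 < r → 0 ≤ T r := fun r hr => by
    refine setIntegral_nonneg measurableSet_Ioi fun u hu => ?_
    have : 0 ≤ u ^ (p + 1) := Real.rpow_nonneg (hr.trans hu).le _
    positivity
  have hΨT : ∀ r, 0 < r → |Ψ r| ≤ Real.exp (-S r / 2) * T r := by
    intro r hr
    have e : Ψ r = -∫ u in Ioi r, w u := by
      have := intervalIntegral.integral_Ioi_sub_Ioi hwint hr.le
      rw [hΨ]
      simp only
      rw [← this, hzero, zero_sub]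
    rw [e, abs_neg, hT]
    simp only
    rw [← integral_const_mul]
    rw [← Real.norm_eq_abs]
    refine norm_integral_le_of_norm_le ((hTint.mono_set (Ioi_subset_Ioi hr.le)).const_mul _) ?_
    refine (ae_restrict_iff' measurableSet_Ioi).2 (ae_of_all _ fun u hu => ?_)
    have hu0 : 0 < u := hr.trans hu
    refine (hwle u hu0).trans ?_
    have h1 : 0 < u ^ (p + 1) := Real.rpow_pos_of_pos hu0 _
    have h2 : Real.exp (-S u) ≤ Real.exp (-S r / 2) * Real.exp (-(ε / 2) * u ^ 2) := by
      rw [← Real.exp_add]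
      refine Real.exp_le_exp.2 ?_
      have := hS0 u hu0
      have := hSmono r u hr (le_of_lt (mem_Ioi.1 hu))
      linarith
    calc L * (u ^ (p + 1) * Real.exp (-S u))
        ≤ L * (u ^ (p + 1) * (Real.exp (-S r / 2) * Real.exp (-(ε / 2) * u ^ 2))) := by gcongr
      _ = _ := by ring
  have hTlim : Tendsto T atTop (𝓝 0) := tendsto_setIntegral_Ioi_atTop_zero hTint
  -- The bound on `B` at infinity grows like `r T²`, so decay of `T` alone would not suffice.
  have hrTlim : Tendsto (fun r => r * T r) atTop (𝓝 0) := by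
    have hint2 : IntegrableOn (fun u : ℝ => L * (u ^ (p + 2) * Real.exp (-(ε / 2) * u ^ 2))) (Ioi 0) :=
      (hgauss (p + 2) (by linarith) (ε / 2) (by linarith)).const_mul L
    refine tendsto_of_tendsto_of_tendsto_of_le_of_le' tendsto_const_nhds
      (tendsto_setIntegral_Ioi_atTop_zero hint2) ?_ ?_
    · filter_upwards [eventually_gt_atTop 0] with r hr using mul_nonneg hr.le (hT0 r hr)
    · filter_upwards [eventually_gt_atTop 0] with r hr
      rw [hT]
      simp only
      rw [← integral_const_mul]
      refine setIntegral_mono_on ((hTint.mono_set (Ioi_subset_Ioi hr.le)).const_mul _)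
        (hint2.mono_set (Ioi_subset_Ioi hr.le)) measurableSet_Ioi fun u hu => ?_
      have hu0 : 0 < u := hr.trans hu
      have h1 : 0 < u ^ (p + 1) := Real.rpow_pos_of_pos hu0 _
      rw [show p + 2 = p + 1 + 1 by ring, Real.rpow_add hu0 (p + 1), Real.rpow_one]
      have : r * (L * (u ^ (p + 1) * Real.exp (-(ε / 2) * u ^ 2)))
        ≤ u * (L * (u ^ (p + 1) * Real.exp (-(ε / 2) * u ^ 2))) := by
        have : r ≤ u := le_of_lt (mem_Ioi.1 hu)
        gcongr
      linarith
  set M : ℝ → ℝ := fun r => r ^ (p + 1) * Real.exp (-S r) with hM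
  have hMpos : ∀ r, 0 < r → 0 < M r := fun r hr =>
    mul_pos (Real.rpow_pos_of_pos hr _) (Real.exp_pos _)
  set χ : ℝ → ℝ := fun r => Ψ r * Real.exp (S r) * r ^ (-(p + 1)) with hχ
  -- In terms of `χ`, the second summand is `(1 + p) r M χ²`.
  set B : ℝ → ℝ := fun r => M r * (k r - (1 + p) * χ r) ^ 2 / S1 r
        - (1 + p) * (r ^ (-p) * Real.exp (S r) * Ψ r ^ 2) with hB
  have hMint : IntegrableOn M (Ioi 0) := by
    refine (hgauss (p + 1) (by linarith) ε hε).mono'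
      (((hrpow _).mul hexpc.continuousOn).aestronglyMeasurable measurableSet_Ioi) ?_
    refine (ae_restrict_iff' measurableSet_Ioi).2 (ae_of_all _ fun r hr => ?_)
    rw [Real.norm_of_nonneg (hMpos r hr).le]
    have := hexple r hr
    have h1 : 0 < r ^ (p + 1) := Real.rpow_pos_of_pos hr _
    rw [hM]
    simp only
    gcongr
  have hIint : IntegrableOn (fun r => M r * (Q r - k r ^ 2)) (Ioi 0) := by
    have hb := ((hgauss (p + 1) (by linarith) ε hε).const_mul L).add
      ((hgauss (p + 3) (by linarith) ε hε).const_mul (L ^ 2))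
    refine hb.mono' ((((hrpow _).mul hexpc.continuousOn).mul
      (hQ.sub (hkcont.pow 2)).continuousOn).aestronglyMeasurable measurableSet_Ioi) ?_
    refine (ae_restrict_iff' measurableSet_Ioi).2 (ae_of_all _ fun r hr => ?_)
    have hr0 : 0 < r := hr
    have h1 : 0 < r ^ (p + 1) := Real.rpow_pos_of_pos hr _
    have h3 : r ^ (p + 3) = r ^ (p + 1) * r ^ 2 := by
      rw [show p + 3 = p + 1 + 2 by ring, Real.rpow_add hr0 (p + 1)]; norm_num
    rw [norm_mul, Real.norm_of_nonneg (hMpos r hr).le]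
    have h4 : ‖Q r - k r ^ 2‖ ≤ L + L ^ 2 * r ^ 2 := by
      refine (norm_sub_le _ _).trans ?_
      rw [norm_pow, Real.norm_eq_abs, Real.norm_eq_abs]
      have := hQL r
      have h5 : |k r| ^ 2 ≤ (L * r) ^ 2 := pow_le_pow_left₀ (abs_nonneg _) (hkL r hr) 2
      linarith [mul_pow L r 2]
    have h6 : M r ≤ r ^ (p + 1) * Real.exp (-ε * r ^ 2) := by
      have := hexple r hr
      rw [hM]
      simp only
      gcongr
    calc M r * ‖Q r - k r ^ 2‖
        ≤ (r ^ (p + 1) * Real.exp (-ε * r ^ 2)) * (L + L ^ 2 * r ^ 2) := by gcongr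
      _ = _ := by simp only [Pi.add_apply, h3]; ring
  have hBd : ∀ r, 0 < r → ∃ B', HasDerivAt B B' r ∧ B' ≤ M r * (Q r - k r ^ 2) - c * M r := by
    intro r hr
    have hs : 0 < S1 r := (mul_pos hε hr).trans_le (hS1pos r hr)
    obtain ⟨ξ, h⟩ := HasDerivAt.weighted_remainder (p := p) hr (hS r) (hS1 r) (hk r) hs (hΨd r hr)
    refine ⟨_, h, ?_⟩
    have h1 := hess r hr ξ
    have h2 := mul_le_mul_of_nonneg_left h1 (hMpos r hr).le
    have h3 : 0 ≤ (1 + p) * (r ^ (p + 1) * Real.exp (-S r) *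
          ((Ψ r * Real.exp (S r) * r ^ (-(p + 1))) ^ 2 +
            (ξ * S1 r + r * (Ψ r * Real.exp (S r) * r ^ (-(p + 1))) * S1 r) ^ 2 / (r * S1 r))) := by
      have h4 : 0 ≤ 1 + p := by linarith
      have h5 := (hMpos r hr).le
      positivity
    have h6 : M r = r ^ (p + 1) * Real.exp (-S r) := rfl
    rw [← h6] at h3 ⊢
    nlinarith [h2, h3]
  have hBbound : ∀ r, 0 < r → |B r| ≤ 2 * L ^ 2 / ε * (M r * r)
      + (2 * (1 + p) ^ 2 / ε * r ^ (-(p + 2)) + (1 + p) * r ^ (-p)) *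
        (Real.exp (S r) * Ψ r ^ 2) := by
    intro r hr
    have hp1 : 0 ≤ 1 + p := by linarith
    have hs : 0 < ε * r := mul_pos hε hr
    have h1 : 0 < r ^ (-p) := Real.rpow_pos_of_pos hr _
    have hMr := hMpos r hr
    rw [hB]
    refine (abs_sub _ _).trans ?_
    have h2 : M r * χ r ^ 2 = r ^ (-(p + 2)) * r * (Real.exp (S r) * Ψ r ^ 2) := by
      have a1 : r ^ (p + 1) * r ^ (-(p + 1)) = 1 := by
        rw [← Real.rpow_add hr]; simp
      have a2 : Real.exp (-S r) * Real.exp (S r) = 1 := by rw [← Real.exp_add]; simp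
      have a3 : r ^ (-(p + 2)) * r = r ^ (-(p + 1)) := by
        rw [← Real.rpow_add_one hr.ne']; congr 1; ring
      rw [a3, hM, hχ]
      simp only
      calc _ = (r ^ (p + 1) * r ^ (-(p + 1))) * (Real.exp (-S r) * Real.exp (S r)) *
            (r ^ (-(p + 1)) * (Real.exp (S r) * Ψ r ^ 2)) := by ring
        _ = _ := by rw [a1, a2]; ring
    have h3 : |M r * (k r - (1 + p) * χ r) ^ 2 / S1 r| ≤
        2 * L ^ 2 / ε * (M r * r) + 2 * (1 + p) ^ 2 / ε * r ^ (-(p + 2)) *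
          (Real.exp (S r) * Ψ r ^ 2) := by
      rw [abs_of_nonneg (by have := hs.trans_le (hS1pos r hr); positivity)]
      have h4 : M r * (k r - (1 + p) * χ r) ^ 2 / S1 r ≤
          M r * (k r - (1 + p) * χ r) ^ 2 / (ε * r) := by
        have := hS1pos r hr
        gcongr
      refine h4.trans ?_
      rw [div_le_iff₀ hs]
      have h5 : (k r - (1 + p) * χ r) ^ 2 ≤ 2 * (L * r) ^ 2 + 2 * (1 + p) ^ 2 * χ r ^ 2 := by
        have h6 : k r ^ 2 ≤ (L * r) ^ 2 := sq_le_sq' (by linarith [(abs_le.1 (hkL r hr)).1])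
          (abs_le.1 (hkL r hr)).2
        nlinarith [sq_nonneg (k r + (1 + p) * χ r)]
      calc M r * (k r - (1 + p) * χ r) ^ 2
          ≤ M r * (2 * (L * r) ^ 2 + 2 * (1 + p) ^ 2 * χ r ^ 2) := by gcongr
        _ = 2 * L ^ 2 * r * (M r * r) + 2 * (1 + p) ^ 2 * (M r * χ r ^ 2) := by ring
        _ = _ := by rw [h2]; field_simp
    have h7 : |(1 + p) * (r ^ (-p) * Real.exp (S r) * Ψ r ^ 2)| =
        (1 + p) * r ^ (-p) * (Real.exp (S r) * Ψ r ^ 2) := by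
      rw [abs_of_nonneg (by positivity)]; ring
    rw [h7]
    linarith
  have hp1 : 0 < 1 + p := by linarith
  have hB0 : Tendsto B (𝓝[>] 0) (𝓝 0) := by
    have hpow : ∀ s : ℝ, 0 < s → Tendsto (fun r : ℝ => r ^ s) (𝓝[>] 0) (𝓝 0) := by
      intro s hs
      have := (Real.continuousAt_rpow_const 0 s (Or.inr hs.le)).tendsto
      rw [Real.zero_rpow hs.ne'] at this
      exact this.mono_left nhdsWithin_le_nhds
    have hE : Tendsto (fun r => Real.exp (S r)) (𝓝[>] 0) (𝓝 (Real.exp (S 0))) :=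
      (Real.continuous_exp.comp hScont).continuousAt.tendsto.mono_left nhdsWithin_le_nhds
    have hlim := ((hpow (p + 2) (by linarith)).const_mul (2 * L ^ 2 / ε)).add
      (((((hpow (p + 2) (by linarith)).const_mul (2 * (1 + p) ^ 2 / ε)).add
        ((hpow (p + 4) (by linarith)).const_mul (1 + p))).mul hE).mul_const (L ^ 2))
    simp only [mul_zero, add_zero, zero_mul] at hlim
    refine squeeze_zero_norm' ?_ hlim
    filter_upwards [self_mem_nhdsWithin] with r hr
    have hr : 0 < r := hr
    refine (hBbound r hr).trans ?_
    have a1 : M r * r ≤ r ^ (p + 2) := by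
      have h3 : Real.exp (-S r) ≤ 1 := by
        rw [Real.exp_le_one_iff]
        have := hS0 r hr
        have : 0 ≤ ε * r ^ 2 := by positivity
        linarith
      have h4 : 0 < r ^ (p + 1) := Real.rpow_pos_of_pos hr _
      calc M r * r = r ^ (p + 1) * Real.exp (-S r) * r := rfl
        _ ≤ r ^ (p + 1) * 1 * r := by gcongr
        _ = _ := by rw [show p + 2 = p + 1 + 1 by ring, Real.rpow_add hr (p + 1), Real.rpow_one]; ring
    have a2 : Ψ r ^ 2 ≤ L ^ 2 * (r ^ (p + 2)) ^ 2 := by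
      rw [← mul_pow, ← sq_abs]
      exact pow_le_pow_left₀ (abs_nonneg _) (hΨ0 r hr) 2
    have a3 : r ^ (-(p + 2)) * (r ^ (p + 2)) ^ 2 = r ^ (p + 2) := by
      rw [Real.rpow_neg hr.le]
      have := (Real.rpow_pos_of_pos hr (p + 2)).ne'
      field_simp
    have a4 : r ^ (-p) * (r ^ (p + 2)) ^ 2 = r ^ (p + 4) := by
      rw [← Real.rpow_natCast, ← Real.rpow_mul hr.le, ← Real.rpow_add hr]
      congr 1
      push_cast
      ring
    have h5 : 0 < r ^ (-(p + 2)) := Real.rpow_pos_of_pos hr _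
    have h6 : 0 < r ^ (-p) := Real.rpow_pos_of_pos hr _
    calc _ ≤ 2 * L ^ 2 / ε * r ^ (p + 2)
      + (2 * (1 + p) ^ 2 / ε * r ^ (-(p + 2)) + (1 + p) * r ^ (-p)) *
        (Real.exp (S r) * (L ^ 2 * (r ^ (p + 2)) ^ 2)) := by gcongr
      _ = 2 * L ^ 2 / ε * r ^ (p + 2)
      + (2 * (1 + p) ^ 2 / ε * (r ^ (-(p + 2)) * (r ^ (p + 2)) ^ 2) +
          (1 + p) * (r ^ (-p) * (r ^ (p + 2)) ^ 2)) *
        (Real.exp (S r) * L ^ 2) := by ring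
      _ = _ := by rw [a3, a4]; ring
  have hBtop : Tendsto B atTop (𝓝 0) := by
    have hg : Tendsto (fun r : ℝ => r ^ (p + 2) * Real.exp (-ε * r ^ 2)) atTop (𝓝 0) := by
      have h1 := (rpow_mul_exp_neg_mul_sq_isLittleO_exp_neg hε (p + 2))
      refine h1.trans_tendsto ?_
      exact Real.tendsto_exp_atBot.comp
        ((tendsto_id.const_mul_atTop_of_neg (by norm_num : -(1 / 2 : ℝ) < 0)))
    have hlim := (hg.const_mul (2 * L ^ 2 / ε)).add
      ((hrTlim.mul hTlim).const_mul (2 * (1 + p) ^ 2 / ε + (1 + p)))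
    simp only [mul_zero, add_zero] at hlim
    refine squeeze_zero_norm' ?_ hlim
    filter_upwards [eventually_ge_atTop 1] with r hr1
    have hr : 0 < r := by linarith
    refine (hBbound r hr).trans ?_
    have a1 : M r * r ≤ r ^ (p + 2) * Real.exp (-ε * r ^ 2) := by
      have h3 := hexple r hr
      have h4 : 0 < r ^ (p + 1) := Real.rpow_pos_of_pos hr _
      calc M r * r = r ^ (p + 1) * Real.exp (-S r) * r := rfl
        _ ≤ r ^ (p + 1) * Real.exp (-ε * r ^ 2) * r := by gcongr
        _ = _ := by rw [show p + 2 = p + 1 + 1 by ring, Real.rpow_add hr (p + 1), Real.rpow_one]; ring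
    have a2 : Real.exp (S r) * Ψ r ^ 2 ≤ T r ^ 2 := by
      have h1 : Ψ r ^ 2 ≤ (Real.exp (-S r / 2) * T r) ^ 2 := by
        rw [← sq_abs]
        exact pow_le_pow_left₀ (abs_nonneg _) (hΨT r hr) 2
      calc Real.exp (S r) * Ψ r ^ 2 ≤ Real.exp (S r) * (Real.exp (-S r / 2) * T r) ^ 2 := by gcongr
        _ = (Real.exp (S r) * Real.exp (-S r / 2) * Real.exp (-S r / 2)) * T r ^ 2 := by ring
        _ = T r ^ 2 := by
          rw [← Real.exp_add, ← Real.exp_add, show S r + -S r / 2 + -S r / 2 = 0 by ring]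
          simp
    -- Both exponents `-(p + 2)` and `-p` are at most `1` because `p > -1`.
    have a3 : r ^ (-(p + 2)) ≤ r := by
      conv_rhs => rw [← Real.rpow_one r]
      exact Real.rpow_le_rpow_of_exponent_le hr1 (by linarith)
    have a4 : r ^ (-p) ≤ r := by
      conv_rhs => rw [← Real.rpow_one r]
      exact Real.rpow_le_rpow_of_exponent_le hr1 (by linarith)
    have h5 : 0 < r ^ (-(p + 2)) := Real.rpow_pos_of_pos hr _
    have h6 : 0 < r ^ (-p) := Real.rpow_pos_of_pos hr _
    calc _ ≤ 2 * L ^ 2 / ε * (r ^ (p + 2) * Real.exp (-ε * r ^ 2))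
      + (2 * (1 + p) ^ 2 / ε * r + (1 + p) * r) * T r ^ 2 := by gcongr
      _ = _ := by ring
  have hFint : IntegrableOn (fun r => M r * (Q r - k r ^ 2) - c * M r) (Ioi 0) :=
    hIint.sub (hMint.const_mul c)
  -- The one-sided form of the fundamental theorem needs integrability of the upper bound only, not
  -- of `B'`.
  have hcmp : ∀ a b, 0 < a → a ≤ b →
      B b - B a ≤ ∫ r in a..b, (M r * (Q r - k r ^ 2) - c * M r) := by
    intro a b ha hab
    choose! B' hB' hB'le using hBd
    refine intervalIntegral.sub_le_integral_of_hasDeriv_right_of_le hab ?_ (g' := B') ?_ ?_ ?_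
    · exact fun x hx => (hB' x (ha.trans_le hx.1)).continuousAt.continuousWithinAt
    · exact fun x hx => (hB' x (ha.trans hx.1)).hasDerivWithinAt
    · exact hFint.mono_set fun x hx => ha.trans_le hx.1
    · exact fun x hx => hB'le x (ha.trans hx.1)
  have h1 : ∀ a, 0 < a → - B a ≤ ∫ r in Ioi a, (M r * (Q r - k r ^ 2) - c * M r) := by
    intro a ha
    have t1 := intervalIntegral_tendsto_integral_Ioi a
      (hFint.mono_set (Ioi_subset_Ioi ha.le)) tendsto_id
    have t2 : Tendsto (fun b => B b - B a) atTop (𝓝 (0 - B a)) := hBtop.sub_const _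
    rw [zero_sub] at t2
    refine le_of_tendsto_of_tendsto t2 t1 ?_
    filter_upwards [eventually_ge_atTop a] with b hb using hcmp a b ha hb
  have h2 : 0 ≤ ∫ r in Ioi (0 : ℝ), (M r * (Q r - k r ^ 2) - c * M r) := by
    have t1 : Tendsto (fun a => -B a) (𝓝[>] 0) (𝓝 0) := by simpa using hB0.neg
    have t2 : Tendsto (fun a => ∫ r in Ioi a, (M r * (Q r - k r ^ 2) - c * M r)) (𝓝[>] 0)
        (𝓝 (∫ r in Ioi (0 : ℝ), (M r * (Q r - k r ^ 2) - c * M r))) :=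
      hFint.continuousWithinAt_Ici_primitive_Ioi.tendsto.mono_left
        (nhdsWithin_mono _ Ioi_subset_Ici_self)
    refine le_of_tendsto_of_tendsto t1 t2 ?_
    filter_upwards [self_mem_nhdsWithin] with a ha using h1 a ha
  rw [integral_sub hIint (hMint.const_mul c), integral_const_mul] at h2
  have h3 : 0 < ∫ r in Ioi (0 : ℝ), M r := by
    rw [setIntegral_pos_iff_support_of_nonneg_ae
      ((ae_restrict_iff' measurableSet_Ioi).2 (ae_of_all _ fun r hr => (hMpos r hr).le)) hMint]
    have : Function.support M ∩ Ioi 0 = Ioi 0 :=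
      inter_eq_right.2 fun r hr => (hMpos r hr).ne'
    rw [this]
    simp
  have := mul_pos hc h3
  linarith

/-- A `C²`-type function all of whose critical points are strict local maxima has no interior
minimum on an interval. -/
theorem min_le_of_deriv2_neg {H H1 H2 : ℝ → ℝ} (h1 : ∀ y, HasDerivAt H (H1 y) y)
    (h2 : ∀ y, HasDerivAt H1 (H2 y) y) (hcrit : ∀ y, H1 y = 0 → H2 y < 0) {t : ℝ}
    (ht : t ∈ Icc (0 : ℝ) 1) : min (H 0) (H 1) ≤ H t := by
  by_contra! hlt
  have hcont : Continuous H := continuous_iff_continuousAt.2 fun y => (h1 y).continuousAt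
  obtain ⟨s, hs, hmin⟩ := isCompact_Icc.exists_isMinOn ⟨t, ht⟩ hcont.continuousOn
  have hst : H s ≤ H t := hmin ht
  have hs0 : s ≠ 0 := by rintro rfl; exact absurd (min_le_left (H 0) (H 1)) (by linarith)
  have hs1 : s ≠ 1 := by rintro rfl; exact absurd (min_le_right (H 0) (H 1)) (by linarith)
  have hloc : IsLocalMin H s := hmin.isLocalMin
    (Icc_mem_nhds (lt_of_le_of_ne hs.1 hs0.symm) (lt_of_le_of_ne hs.2 hs1))
  have hH1 : H1 s = 0 := hloc.hasDerivAt_eq_zero (h1 s)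
  have hd : deriv H = H1 := funext fun y => (h1 y).deriv
  have hmax : IsLocalMax H s := by
    refine isLocalMax_of_deriv_deriv_neg ?_ ?_ hcont.continuousAt
    · rw [hd, (h2 s).deriv]; exact hcrit s hH1
    · rw [hd, hH1]
  -- Being both a local minimum and a local maximum at `s`, `H` is constant near `s`, which
  -- contradicts `H2 s < 0`.
  have hev : H =ᶠ[𝓝 s] fun _ => H s := by
    filter_upwards [hloc, hmax] with y hy1 hy2 using le_antisymm hy2 hy1
  have h3 : deriv H =ᶠ[𝓝 s] fun _ => 0 := by
    filter_upwards [hev.eventuallyEq_nhds] with y hy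
    rw [hy.deriv_eq]; simp
  have h4 : deriv (deriv H) s = 0 := by rw [h3.deriv_eq]; simp
  rw [hd, (h2 s).deriv] at h4
  exact absurd h4 (hcrit s hH1).ne

/-! ### Quasi-concavity of ray moments for smooth, uniformly convex potentials. -/

section

variable {E : Type*} [NormedAddCommGroup E] [InnerProductSpace ℝ E]

/-- The (regularized) radial moment of order `p` of a function along the ray through `x`. -/
noncomputable def rayMoment (p : ℝ) (f : E → ℝ) (x : E) : ℝ :=
  ∫ r in Ioi (0 : ℝ), r ^ (p - 1) * (f (r • x) - if p < 0 then 1 else 0)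

/-- An integrable majorant for the integrand of `rayMoment`. -/
noncomputable def rayBound (p A c r : ℝ) : ℝ :=
  r ^ (p - 1) * if p < 0 then min 1 (A * r) else A * Real.exp (-c * r)

/-- For `p < 0` the factor `min 1 (A * r)` leaves `r^p` near `0`, integrable since `p > -1`, and
`r^(p-1)` at infinity, integrable since `p < 0`. For `p > 0` this is a Gamma integral. -/
theorem integrableOn_rayBound {p A c : ℝ} (hp : -1 < p) (hp0 : p ≠ 0) (hA : 0 ≤ A) (hc : 0 < c) :
    IntegrableOn (rayBound p A c) (Ioi 0) := by
  have hrpow : ∀ s : ℝ, ContinuousOn (fun r : ℝ => r ^ s) (Ioi 0) := fun s r hr =>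
    (Real.continuousAt_rpow_const _ _ (Or.inl (ne_of_gt hr))).continuousWithinAt
  unfold rayBound
  rcases hp0.lt_or_gt with h | h
  · simp only [h, if_true]
    rw [← Ioc_union_Ioi_eq_Ioi zero_le_one]
    have hm : ContinuousOn (fun r : ℝ => r ^ (p - 1) * min 1 (A * r)) (Ioi 0) :=
      (hrpow _).mul (by fun_prop)
    refine IntegrableOn.union ?_ ?_
    · have hi : IntegrableOn (fun r : ℝ => r ^ p * A) (Ioc 0 1) := by
        rw [← intervalIntegrable_iff_integrableOn_Ioc_of_le zero_le_one]
        exact (intervalIntegral.intervalIntegrable_rpow' hp).mul_const A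
      refine hi.mono' ((hm.mono Ioc_subset_Ioi_self).aestronglyMeasurable measurableSet_Ioc) ?_
      refine (ae_restrict_iff' measurableSet_Ioc).2 (ae_of_all _ fun r hr => ?_)
      have hr0 : 0 < r := hr.1
      have h1 : 0 < r ^ (p - 1) := Real.rpow_pos_of_pos hr0 _
      rw [Real.norm_of_nonneg (mul_nonneg h1.le (le_min zero_le_one (by positivity)))]
      calc r ^ (p - 1) * min 1 (A * r) ≤ r ^ (p - 1) * (A * r) := by
            gcongr; exact min_le_right _ _
        _ = _ := by rw [Real.rpow_sub_one hr0.ne']; field_simp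
    · refine (integrableOn_Ioi_rpow_of_lt (by linarith : p - 1 < -1) one_pos).mono'
        ((hm.mono (Ioi_subset_Ioi zero_le_one)).aestronglyMeasurable measurableSet_Ioi) ?_
      refine (ae_restrict_iff' measurableSet_Ioi).2 (ae_of_all _ fun r hr => ?_)
      have hr0 : 0 < r := one_pos.trans hr
      have h1 : 0 < r ^ (p - 1) := Real.rpow_pos_of_pos hr0 _
      rw [Real.norm_of_nonneg (mul_nonneg h1.le (le_min zero_le_one (by positivity)))]
      calc r ^ (p - 1) * min 1 (A * r) ≤ r ^ (p - 1) * 1 := by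
            gcongr; exact min_le_left _ _
        _ = _ := mul_one _
  · simp only [h.not_gt, if_false]
    have := (integrableOn_rpow_mul_exp_neg_mul_rpow (p := 1) (by linarith : -1 < p - 1)
      one_pos hc).const_mul A
    refine IntegrableOn.congr_fun this (fun r _ => ?_) measurableSet_Ioi
    simp only [Real.rpow_one]
    ring

theorem norm_le_rayBound {p A c r y : ℝ} (hr : 0 < r) (h0 : 0 ≤ y) (h1 : y ≤ 1)
    (hA : 1 - y ≤ A * r) (hc : y ≤ A * Real.exp (-c * r)) :
    ‖r ^ (p - 1) * (y - if p < 0 then 1 else 0)‖ ≤ rayBound p A c r := by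
  have h2 : 0 < r ^ (p - 1) := Real.rpow_pos_of_pos hr _
  rw [rayBound, norm_mul, Real.norm_of_nonneg h2.le]
  gcongr
  split_ifs with hp
  · rw [Real.norm_of_nonpos (by linarith)]
    exact le_min (by linarith) (by linarith)
  · rw [sub_zero, Real.norm_of_nonneg h0]
    exact hc

/-- A point off a closed line has positive distance to it. This converts linear independence into
uniform lower bounds. -/
theorem exists_pos_le_norm_sub_smul {u w : E} (h : ∀ a : ℝ, w - a • u ≠ 0) :
    ∃ d > 0, ∀ a : ℝ, d ≤ ‖w - a • u‖ := by
  have hcl : IsClosed (Submodule.span ℝ {u} : Set E) := Submodule.closed_of_finiteDimensional _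
  have hw : w ∉ (Submodule.span ℝ {u} : Set E) := by
    intro hw
    obtain ⟨a, ha⟩ := Submodule.mem_span_singleton.1 hw
    exact h a (by rw [ha, sub_self])
  refine ⟨Metric.infDist w (Submodule.span ℝ {u} : Set E),
    (hcl.notMem_iff_infDist_pos ⟨0, Submodule.zero_mem _⟩).1 hw, fun a => ?_⟩
  rw [← dist_eq_norm]
  exact Metric.infDist_le_dist_of_mem (Submodule.mem_span_singleton.2 ⟨a, rfl⟩)

variable {φ : E → ℝ} {ε L : ℝ}

/-- The Hessian bounds are integrated along the ray from the critical point `0`, where `φ` vanishes.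
The last bound comes from the mean value inequality, hence `L` rather than `L / 2`. -/
theorem ray_estimates (hφ : ContDiff ℝ 2 φ) (h0 : φ 0 = 0) (hd0 : fderiv ℝ φ 0 = 0)
    (hlow : ∀ z w, ε * ‖w‖ ^ 2 ≤ fderiv ℝ (fderiv ℝ φ) z w w)
    (hup : ∀ z, ‖fderiv ℝ (fderiv ℝ φ) z‖ ≤ L) (z : E) :
    (∀ r, HasDerivAt (fun r : ℝ => φ (r • z)) (fderiv ℝ φ (r • z) z) r) ∧
    (∀ v r, HasDerivAt (fun r : ℝ => fderiv ℝ φ (r • z) v)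
      (fderiv ℝ (fderiv ℝ φ) (r • z) z v) r) ∧
    (∀ r, 0 ≤ r → ε * ‖z‖ ^ 2 * r ≤ fderiv ℝ φ (r • z) z) ∧
    (∀ r, 0 ≤ r → ε * ‖z‖ ^ 2 / 2 * r ^ 2 ≤ φ (r • z)) ∧
    (∀ v r, 0 ≤ r → |fderiv ℝ φ (r • z) v| ≤ L * ‖z‖ * ‖v‖ * r) ∧
    (∀ r, 0 ≤ r → φ (r • z) ≤ L * ‖z‖ ^ 2 * r ^ 2) := by
  have hφd : Differentiable ℝ φ := hφ.differentiable (by norm_num)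
  have hφ1 : ContDiff ℝ 1 (fderiv ℝ φ) := hφ.fderiv_right (by norm_num)
  have hφ1d : Differentiable ℝ (fderiv ℝ φ) := hφ1.differentiable (by norm_num)
  have hray : ∀ r : ℝ, HasDerivAt (fun r : ℝ => r • z) z r := fun r => by
    simpa using (hasDerivAt_id r).smul_const z
  have a1 : ∀ r, HasDerivAt (fun r : ℝ => φ (r • z)) (fderiv ℝ φ (r • z) z) r := fun r =>
    (hφd (r • z)).hasFDerivAt.comp_hasDerivAt r (hray r)
  have a2 : ∀ v r, HasDerivAt (fun r : ℝ => fderiv ℝ φ (r • z) v)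
      (fderiv ℝ (fderiv ℝ φ) (r • z) z v) r := fun v r => by
    have := (hφ1d (r • z)).hasFDerivAt.comp_hasDerivAt r (hray r)
    simpa using! this.clm_apply (hasDerivAt_const r v)
  have a3 : ∀ r, 0 ≤ r → ε * ‖z‖ ^ 2 * r ≤ fderiv ℝ φ (r • z) z := by
    intro r hr
    have hd : ∀ r, HasDerivAt (fun r : ℝ => fderiv ℝ φ (r • z) z - ε * ‖z‖ ^ 2 * r)
        (fderiv ℝ (fderiv ℝ φ) (r • z) z z - ε * ‖z‖ ^ 2) r := fun r => by
      simpa using! (a2 z r).sub ((hasDerivAt_id r).const_mul (ε * ‖z‖ ^ 2))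
    have := monotone_of_hasDerivAt_nonneg hd (fun r => by
      have := hlow (r • z) z
      simp only [Pi.zero_apply]; linarith) hr
    simp only [zero_smul, hd0] at this
    simp at this
    linarith
  have a4 : ∀ r, 0 ≤ r → ε * ‖z‖ ^ 2 / 2 * r ^ 2 ≤ φ (r • z) := by
    intro r hr
    have hd : ∀ r, HasDerivAt (fun r : ℝ => φ (r • z) - ε * ‖z‖ ^ 2 / 2 * r ^ 2)
        (fderiv ℝ φ (r • z) z - ε * ‖z‖ ^ 2 * r) r := fun r => by
      have := (a1 r).sub ((hasDerivAt_pow 2 r).const_mul (ε * ‖z‖ ^ 2 / 2))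
      refine this.congr_deriv ?_
      norm_num
      ring
    have hm : MonotoneOn (fun r : ℝ => φ (r • z) - ε * ‖z‖ ^ 2 / 2 * r ^ 2) (Ici 0) := by
      refine monotoneOn_of_deriv_nonneg (convex_Ici 0)
        (fun x _ => (hd x).continuousAt.continuousWithinAt)
        (fun x _ => (hd x).differentiableAt.differentiableWithinAt) fun x hx => ?_
      rw [interior_Ici] at hx
      rw [(hd x).deriv]
      linarith [a3 x (le_of_lt hx)]
    have := hm self_mem_Ici hr hr
    simp [h0] at this
    linarith
  have hgrad : ∀ w, ‖fderiv ℝ φ w‖ ≤ L * ‖w‖ := by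
    intro w
    have := convex_univ.norm_image_sub_le_of_norm_fderiv_le (𝕜 := ℝ) (f := fderiv ℝ φ) (x := 0) (y := w)
      (fun x _ => hφ1d x) (fun x _ => hup x) (mem_univ _) (mem_univ _)
    simpa [hd0] using this
  refine ⟨a1, a2, a3, a4, ?_, ?_⟩
  · intro v r hr
    refine ((fderiv ℝ φ (r • z)).le_opNorm v).trans ?_
    have := hgrad (r • z)
    rw [norm_smul, Real.norm_of_nonneg hr] at this
    calc _ ≤ L * (r * ‖z‖) * ‖v‖ := by gcongr
      _ = _ := by ring
  · intro r hr
    have hz : ∀ w ∈ Metric.closedBall (0 : E) ‖r • z‖, ‖fderiv ℝ φ w‖ ≤ L * ‖r • z‖ := by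
      intro w hw
      have hL : 0 ≤ L := (norm_nonneg (fderiv ℝ (fderiv ℝ φ) 0)).trans (hup 0)
      refine (hgrad w).trans ?_
      have : ‖w‖ ≤ ‖r • z‖ := by simpa using hw
      gcongr
    have := (convex_closedBall (0 : E) ‖r • z‖).norm_image_sub_le_of_norm_fderiv_le (𝕜 := ℝ)
      (f := φ) (x := 0) (y := r • z) (fun x _ => hφd x) hz (by simp) (by simp)
    rw [h0, sub_zero, sub_zero, norm_smul, Real.norm_of_nonneg hr] at this
    calc φ (r • z) ≤ ‖φ (r • z)‖ := Real.le_norm_self _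
      _ ≤ _ := this
      _ = _ := by ring

/-- Brings quadratic growth along a ray into the form `norm_le_rayBound` asks for, with rate `1`.
The decay part is the completed square `a r² - r + 1/(4a) ≥ 0`. -/
theorem exp_neg_ray_mem_class {a C r s : ℝ} (ha : 0 < a) (hr : 0 < r) (h1 : a * r ^ 2 ≤ s)
    (h2 : s ≤ C * r ^ 2) :
    1 - Real.exp (-s) ≤ max (max 1 C) (Real.exp (1 / (4 * a))) * r ∧
      Real.exp (-s) ≤ max (max 1 C) (Real.exp (1 / (4 * a))) * Real.exp (-1 * r) := by
  constructor
  · have h3 : 1 - Real.exp (-s) ≤ s := by linarith [Real.add_one_le_exp (-s)]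
    have h4 : 1 - Real.exp (-s) ≤ 1 := by linarith [Real.exp_pos (-s)]
    have h5 : 1 - Real.exp (-s) ≤ max 1 C * r := by
      rcases le_total r 1 with h | h
      · have h6 : C * r ^ 2 ≤ max 1 C * r ^ 2 := by gcongr; exact le_max_right _ _
        have h7 : max 1 C * r ^ 2 ≤ max 1 C * r := by
          have : 0 ≤ max 1 C := zero_le_one.trans (le_max_left _ _)
          gcongr
          nlinarith
        linarith
      · have : 1 * 1 ≤ max 1 C * r := by
          gcongr
          exact le_max_left _ _
        linarith
    exact h5.trans (mul_le_mul_of_nonneg_right (le_max_left _ _) hr.le)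
  · calc Real.exp (-s) ≤ Real.exp (1 / (4 * a)) * Real.exp (-1 * r) := by
          rw [← Real.exp_add]
          refine Real.exp_le_exp.2 ?_
          have : 0 ≤ (2 * a * r - 1) ^ 2 / (4 * a) := by positivity
          have e : (2 * a * r - 1) ^ 2 / (4 * a) = a * r ^ 2 - r + 1 / (4 * a) := by
            field_simp; ring
          linarith
      _ ≤ _ := by gcongr; exact le_max_right _ _

theorem rayMoment_quasiconcave_of_smooth {p : ℝ} (hp : -1 < p) (hp0 : p ≠ 0) (hε : 0 < ε)
    (hφ : ContDiff ℝ 2 φ) (h0 : φ 0 = 0) (hd0 : fderiv ℝ φ 0 = 0)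
    (hlow : ∀ z w, ε * ‖w‖ ^ 2 ≤ fderiv ℝ (fderiv ℝ φ) z w w)
    (hup : ∀ z, ‖fderiv ℝ (fderiv ℝ φ) z‖ ≤ L) {x v : E}
    (hind : ∀ a b : ℝ, a • x + b • v = 0 → a = 0 ∧ b = 0) {t : ℝ} (ht : t ∈ Icc (0 : ℝ) 1) :
    min (rayMoment p (fun z => Real.exp (-φ z)) x) (rayMoment p (fun z => Real.exp (-φ z)) (x + v))
      ≤ rayMoment p (fun z => Real.exp (-φ z)) (x + t • v) := by
  have hL : 0 ≤ L := (norm_nonneg (fderiv ℝ (fderiv ℝ φ) 0)).trans (hup 0)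
  have hφ1 : ContDiff ℝ 1 (fderiv ℝ φ) := hφ.fderiv_right (by norm_num)
  have hφ2c : Continuous (fderiv ℝ (fderiv ℝ φ)) := hφ1.continuous_fderiv (by norm_num)
  have hφ1c : Continuous (fderiv ℝ φ) := hφ1.continuous
  have hφc : Continuous φ := hφ.continuous
  -- The line `x + ℝ v` misses the origin, so `φ` grows quadratically on all its rays at a common
  -- rate; this is the domination used to differentiate under the integral.
  obtain ⟨d, hd, hdx⟩ : ∃ d > 0, ∀ y : ℝ, d ≤ ‖x + y • v‖ := by
    obtain ⟨d, hd, h⟩ := exists_pos_le_norm_sub_smul (u := v) (w := x) (fun a ha => by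
      have := hind 1 (-a) (by rw [one_smul, neg_smul, ← sub_eq_add_neg, ha])
      exact one_ne_zero this.1)
    exact ⟨d, hd, fun y => by simpa using h (-y)⟩
  set b : ℝ := ε * d ^ 2 / 2 with hb
  have hbpos : 0 < b := by positivity
  have est := fun z => ray_estimates hφ h0 hd0 hlow hup z
  set z : ℝ → E := fun y => x + y • v with hz
  have hzd : ∀ y, HasDerivAt z v y := fun y => by
    have h := ((hasDerivAt_id y).smul_const v).const_add x
    rw [one_smul] at h
    exact h
  have hSb : ∀ y r, 0 < r → b * r ^ 2 ≤ φ (r • z y) := fun y r hr => by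
    refine le_trans ?_ ((est (z y)).2.2.2.1 r hr.le)
    have := hdx y
    rw [hb]
    gcongr
  have hrpow : ∀ s : ℝ, ContinuousOn (fun r : ℝ => r ^ s) (Ioi 0) := fun s r hr =>
    (Real.continuousAt_rpow_const _ _ (Or.inl (ne_of_gt hr))).continuousWithinAt
  have hgauss : ∀ s : ℝ, -1 < s → IntegrableOn (fun r : ℝ => r ^ s * Real.exp (-b * r ^ 2)) (Ioi 0) :=
    fun s hs => integrableOn_rpow_mul_exp_neg_mul_sq hbpos hs
  set F : ℝ → ℝ → ℝ := fun y r => r ^ (p - 1) * (Real.exp (-φ (r • z y)) - if p < 0 then 1 else 0)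
    with hF
  set F1 : ℝ → ℝ → ℝ := fun y r => -(r ^ p * Real.exp (-φ (r • z y)) * fderiv ℝ φ (r • z y) v)
    with hF1
  set F2 : ℝ → ℝ → ℝ := fun y r => -(r ^ (p + 1) * Real.exp (-φ (r • z y)) *
    (fderiv ℝ (fderiv ℝ φ) (r • z y) v v - (fderiv ℝ φ (r • z y) v) ^ 2)) with hF2
  have hmF : ∀ y, AEStronglyMeasurable (F y) (volume.restrict (Ioi 0)) := fun y =>
    ((hrpow _).mul (by fun_prop)).aestronglyMeasurable measurableSet_Ioi
  have hmF1 : ∀ y, AEStronglyMeasurable (F1 y) (volume.restrict (Ioi 0)) := fun y =>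
    (((hrpow _).mul (by fun_prop)).mul (by fun_prop)).neg.aestronglyMeasurable measurableSet_Ioi
  have hmF2 : ∀ y, AEStronglyMeasurable (F2 y) (volume.restrict (Ioi 0)) := fun y =>
    (((hrpow _).mul (by fun_prop)).mul (by fun_prop)).neg.aestronglyMeasurable measurableSet_Ioi
  have hae : ∀ {P : ℝ → Prop}, (∀ r, 0 < r → P r) → ∀ᵐ r ∂(volume.restrict (Ioi (0 : ℝ))), P r :=
    fun h => (ae_restrict_iff' measurableSet_Ioi).2 (ae_of_all _ h)
  have hFint : ∀ y, IntegrableOn (F y) (Ioi 0) := fun y => by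
    refine Integrable.mono' (integrableOn_rayBound hp hp0 (A := max (max 1 (L * ‖z y‖ ^ 2))
      (Real.exp (1 / (4 * b)))) (zero_le_one.trans ((le_max_left _ _).trans (le_max_left _ _)))
      one_pos) (hmF y) (hae fun r hr => ?_)
    have h1 := hSb y r hr
    obtain ⟨h2, h3⟩ := exp_neg_ray_mem_class hbpos hr h1 ((est (z y)).2.2.2.2.2 r hr.le)
    refine norm_le_rayBound hr (Real.exp_pos _).le ?_ h2 h3
    rw [Real.exp_le_one_iff]
    have : 0 ≤ b * r ^ 2 := by positivity
    linarith
  have hzC : ∀ y₀, ∀ y ∈ Metric.ball y₀ 1, L * ‖z y‖ * ‖v‖ ≤ L * (‖x‖ + (|y₀| + 1) * ‖v‖) * ‖v‖ := by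
    intro y₀ y hy
    have h1 : |y| ≤ |y₀| + 1 := by
      rw [Metric.mem_ball, Real.dist_eq] at hy
      have := abs_add_le (y - y₀) y₀
      rw [sub_add_cancel] at this
      linarith
    have h2 : ‖z y‖ ≤ ‖x‖ + (|y₀| + 1) * ‖v‖ := by
      refine (norm_add_le _ _).trans ?_
      rw [norm_smul, Real.norm_eq_abs]
      gcongr
    gcongr
  have hexple : ∀ y r, 0 < r → Real.exp (-φ (r • z y)) ≤ Real.exp (-b * r ^ 2) := fun y r hr =>
    Real.exp_le_exp.2 (by linarith [hSb y r hr])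
  have hF1b : ∀ y₀, ∀ r, 0 < r → ∀ y ∈ Metric.ball y₀ 1, ‖F1 y r‖ ≤
      L * (‖x‖ + (|y₀| + 1) * ‖v‖) * ‖v‖ * (r ^ (p + 1) * Real.exp (-b * r ^ 2)) := by
    intro y₀ r hr y hy
    have h1 := (est (z y)).2.2.2.2.1 v r hr.le
    have h2 := hzC y₀ y hy
    have h3 := hexple y r hr
    have h4 : 0 < r ^ p := Real.rpow_pos_of_pos hr _
    rw [hF1]
    simp only
    rw [norm_neg, norm_mul, Real.norm_of_nonneg (by positivity), Real.norm_eq_abs,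
      Real.rpow_add hr, Real.rpow_one]
    calc r ^ p * Real.exp (-φ (r • z y)) * |fderiv ℝ φ (r • z y) v|
        ≤ r ^ p * Real.exp (-b * r ^ 2) * (L * (‖x‖ + (|y₀| + 1) * ‖v‖) * ‖v‖ * r) := by
          have h5 : |fderiv ℝ φ (r • z y) v| ≤ L * (‖x‖ + (|y₀| + 1) * ‖v‖) * ‖v‖ * r :=
            h1.trans (by gcongr)
          gcongr
      _ = _ := by ring
  have hF1int : ∀ y, IntegrableOn (F1 y) (Ioi 0) := fun y =>
    ((hgauss (p + 1) (by linarith)).const_mul _).mono' (hmF1 y)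
      (hae fun r hr => hF1b y r hr y (Metric.mem_ball_self one_pos))
  have hexpd : ∀ r y, HasDerivAt (fun y => Real.exp (-φ (r • z y)))
      (-(r * Real.exp (-φ (r • z y)) * fderiv ℝ φ (r • z y) v)) y := by
    intro r y
    have h1 := ((hφ.differentiable (by norm_num)) (r • z y)).hasFDerivAt.comp_hasDerivAt y
      ((hzd y).const_smul r)
    refine h1.fun_neg.exp.congr_deriv ?_
    simp only [map_smul, smul_eq_mul, Function.comp, Pi.smul_apply]
    ring
  have hderiv1 : ∀ y, HasDerivAt (fun y => ∫ r in Ioi (0 : ℝ), F y r) (∫ r in Ioi (0 : ℝ), F1 y r) y := by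
    intro y
    refine (hasDerivAt_integral_of_dominated_loc_of_deriv_le (Metric.ball_mem_nhds y one_pos)
      (Eventually.of_forall hmF) (hFint y) (hmF1 y) (hae (hF1b y))
      ((hgauss (p + 1) (by linarith)).const_mul _) (hae fun r hr y' _ => ?_)).2
    have := ((hexpd r y').sub_const (if p < 0 then (1 : ℝ) else 0)).const_mul (r ^ (p - 1))
    refine this.congr_deriv ?_
    rw [Real.rpow_sub_one hr.ne', hF1]
    field_simp
  have hderiv2 : ∀ y, HasDerivAt (fun y => ∫ r in Ioi (0 : ℝ), F1 y r) (∫ r in Ioi (0 : ℝ), F2 y r) y := by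
    intro y
    set C := L * (‖x‖ + (|y| + 1) * ‖v‖) * ‖v‖ with hC
    have hbd : IntegrableOn (fun r : ℝ => L * ‖v‖ ^ 2 * (r ^ (p + 1) * Real.exp (-b * r ^ 2)) +
        C ^ 2 * (r ^ (p + 3) * Real.exp (-b * r ^ 2))) (Ioi 0) :=
      ((hgauss (p + 1) (by linarith)).const_mul _).add ((hgauss (p + 3) (by linarith)).const_mul _)
    refine (hasDerivAt_integral_of_dominated_loc_of_deriv_le (Metric.ball_mem_nhds y one_pos)
      (Eventually.of_forall hmF1) (hF1int y) (hmF2 y) (hae fun r hr y' hy' => ?_)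
      hbd (hae fun r hr y' _ => ?_)).2
    · have h1 := (est (z y')).2.2.2.2.1 v r hr.le
      have h2 := hzC y y' hy'
      have h3 := hexple y' r hr
      have h4 : 0 < r ^ (p + 1) := Real.rpow_pos_of_pos hr _
      have h5 : |fderiv ℝ φ (r • z y') v| ≤ C * r := h1.trans (by gcongr)
      have h6 : ‖fderiv ℝ (fderiv ℝ φ) (r • z y') v v‖ ≤ L * ‖v‖ ^ 2 := by
        refine (ContinuousLinearMap.le_opNorm₂ _ v v).trans ?_
        rw [sq, ← mul_assoc]
        gcongr
        exact hup _
      have h7 : r ^ (p + 3) = r ^ (p + 1) * r ^ 2 := by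
        rw [show p + 3 = p + 1 + 2 by ring, Real.rpow_add hr (p + 1)]; norm_num
      rw [hF2]
      simp only
      rw [norm_neg, norm_mul, Real.norm_of_nonneg (by positivity), h7]
      have h8 : ‖fderiv ℝ (fderiv ℝ φ) (r • z y') v v - (fderiv ℝ φ (r • z y') v) ^ 2‖ ≤
          L * ‖v‖ ^ 2 + (C * r) ^ 2 := by
        refine (norm_sub_le _ _).trans (add_le_add h6 ?_)
        rw [norm_pow, Real.norm_eq_abs]
        exact pow_le_pow_left₀ (abs_nonneg _) h5 2
      calc _ ≤ r ^ (p + 1) * Real.exp (-b * r ^ 2) * (L * ‖v‖ ^ 2 + (C * r) ^ 2) := by gcongr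
        _ = _ := by ring
    · have h1 := ((hφ1.differentiable (by norm_num)) (r • z y')).hasFDerivAt.comp_hasDerivAt y'
        ((hzd y').const_smul r)
      have h2 := h1.clm_apply (hasDerivAt_const y' v)
      have h3 := (((hexpd r y').const_mul (r ^ p)).mul h2).neg
      refine h3.congr_deriv ?_
      rw [hF2]
      simp only [map_smul, smul_eq_mul, Function.comp, smul_apply, map_zero, add_zero,
        Pi.smul_apply, Real.rpow_add_one hr.ne']
      ring
  have hcrit : ∀ y, ∫ r in Ioi (0 : ℝ), F1 y r = 0 → ∫ r in Ioi (0 : ℝ), F2 y r < 0 := by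
    intro y hy
    -- Independence keeps `v - ξ • z y` away from `0` uniformly in `ξ`, so the Hessian in these
    -- directions is at least `ε * c ^ 2`. This makes the second derivative strictly negative.
    obtain ⟨c, hc, hcv⟩ := exists_pos_le_norm_sub_smul (u := z y) (w := v) (fun a ha => by
      have := hind (-a) (1 - a * y) (by
        rw [← ha, hz]; module)
      have h1 : a = 0 := by linarith [this.1]
      have := this.2
      rw [h1] at this
      norm_num at this)
    obtain ⟨e1, e2, e3, e4, e5, e6⟩ := est (z y)
    have hsym : ∀ w, IsSymmSndFDerivAt ℝ φ w := fun w =>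
      hφ.contDiffAt.isSymmSndFDerivAt (by simp)
    have hzy : d ≤ ‖z y‖ := hdx y
    set L' := max (L * ‖z y‖ * ‖v‖) (L * ‖v‖ ^ 2) with hL'
    have key := weighted_hessian_integral_pos (p := p) (ε := b) (L := L') (c := ε * c ^ 2) hp hbpos
      (by positivity) e1 (e2 (z y)) (e2 v) (fun r hr => hSb y r hr) (fun r hr => ?_) (fun r hr => ?_)
      (Q := fun r => fderiv ℝ (fderiv ℝ φ) (r • z y) v v) (by fun_prop) (fun r => ?_)
      (fun r hr ξ => ?_) ?_
    · rw [hF2]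
      simp only
      rw [integral_neg]
      linarith
    · refine le_trans ?_ (e3 r hr.le)
      have h1 : b ≤ ε * ‖z y‖ ^ 2 := by
        have : ε * d ^ 2 ≤ ε * ‖z y‖ ^ 2 := by gcongr
        have : 0 < ε * d ^ 2 := by positivity
        rw [hb]
        linarith
      gcongr
    · refine (e5 v r hr.le).trans ?_
      gcongr
      exact le_max_left _ _
    · refine le_trans ?_ (le_max_right _ _)
      rw [← Real.norm_eq_abs]
      refine (ContinuousLinearMap.le_opNorm₂ _ v v).trans ?_
      rw [sq, ← mul_assoc]
      gcongr
      exact hup _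
    · have h1 := hlow (r • z y) (v - ξ • z y)
      have h2 : ε * c ^ 2 ≤ ε * ‖v - ξ • z y‖ ^ 2 := by
        have := hcv ξ
        gcongr
      refine (h2.trans h1).trans_eq ?_
      have h3 : fderiv ℝ (fderiv ℝ φ) (r • z y) v (z y) =
        fderiv ℝ (fderiv ℝ φ) (r • z y) (z y) v := (hsym (r • z y)) v (z y)
      simp only [map_sub, map_smul, sub_apply, smul_apply,
        smul_eq_mul]
      rw [h3]
      ring
    · rw [hF1] at hy
      simp only at hy
      rw [integral_neg, neg_eq_zero] at hy
      exact hy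
  have := min_le_of_deriv2_neg hderiv1 hderiv2 hcrit ht
  simpa [rayMoment, hF, hz] using this

end

/-! ### Mollification of convex functions and radial control. -/

set_option linter.unusedSectionVars false

-- Moving the point shifts only the argument of `u`, so increments are bounded by `K` times the `L¹`
-- norm of `f`. With `f` the derivative of a bump this bounds the Hessian of a mollification.
open scoped NNReal Convolution in
theorem LipschitzWith.convolution_right {E F G : Type*} [NormedAddCommGroup E] [NormedSpace ℝ E]
    [NormedAddCommGroup F] [NormedSpace ℝ F] [NormedAddCommGroup G] [NormedSpace ℝ G]
    [MeasurableSpace E] [BorelSpace E] [FiniteDimensional ℝ E] {μ : Measure E} [μ.IsAddHaarMeasure]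
    (B : F →L[ℝ] ℝ →L[ℝ] G) {f : E → F} {u : E → ℝ} {K : ℝ≥0} (hf : Continuous f)
    (hfc : HasCompactSupport f) (hu : LipschitzWith K u) :
    ∃ L : ℝ≥0, LipschitzWith L (f ⋆[B, μ] u) := by
  have hfi : Integrable f μ := hf.integrable_of_hasCompactSupport hfc
  refine ⟨‖B‖₊ * K * (∫ t, ‖f t‖ ∂μ).toNNReal, LipschitzWith.of_dist_le_mul fun x y => ?_⟩
  have hex : ∀ x, Integrable (fun t => B (f t) (u (x - t))) μ := fun x =>
    hfc.convolutionExists_left B hf hu.continuous.locallyIntegrable x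
  rw [dist_eq_norm, convolution_def, convolution_def, ← integral_sub (hex x) (hex y)]
  have hb : ∀ t, ‖B (f t) (u (x - t)) - B (f t) (u (y - t))‖ ≤ ‖B‖ * K * dist x y * ‖f t‖ := by
    intro t
    rw [← map_sub]
    refine (B.le_opNorm₂ _ _).trans ?_
    have h := hu.dist_le_mul (x - t) (y - t)
    rw [dist_sub_right, Real.dist_eq] at h
    rw [Real.norm_eq_abs]
    calc ‖B‖ * ‖f t‖ * |u (x - t) - u (y - t)| ≤ ‖B‖ * ‖f t‖ * (K * dist x y) := by gcongr
      _ = _ := by ring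
  refine (norm_integral_le_of_norm_le (hfi.norm.const_mul _) (ae_of_all _ hb)).trans_eq ?_
  rw [integral_const_mul]
  push_cast
  rw [Real.coe_toNNReal _ (integral_nonneg fun _ => norm_nonneg _)]
  ring

/-- On the line through `z` in direction `w` the first derivative is monotone, and the quadratic
form is its derivative. -/
theorem ConvexOn.fderiv_fderiv_nonneg {E : Type*} [NormedAddCommGroup E] [NormedSpace ℝ E]
    {ψ : E → ℝ} (hψ : ContDiff ℝ 2 ψ) (hc : ConvexOn ℝ univ ψ) (z w : E) :
    0 ≤ fderiv ℝ (fderiv ℝ ψ) z w w := by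
  have hψ1 : ContDiff ℝ 1 (fderiv ℝ ψ) := hψ.fderiv_right (by norm_num)
  have hl : ∀ t : ℝ, HasDerivAt (fun t : ℝ => z + t • w) w t := fun t => by
    have h := ((hasDerivAt_id t).smul_const w).const_add z
    rw [one_smul] at h
    exact h
  have h1 : ∀ t, HasDerivAt (fun t : ℝ => ψ (z + t • w)) (fderiv ℝ ψ (z + t • w) w) t := fun t =>
    ((hψ.differentiable (by norm_num)) (z + t • w)).hasFDerivAt.comp_hasDerivAt t (hl t)
  have h2 : HasDerivAt (fun t : ℝ => fderiv ℝ ψ (z + t • w) w)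
      (fderiv ℝ (fderiv ℝ ψ) (z + (0 : ℝ) • w) w w) 0 := by
    have := ((hψ1.differentiable (by norm_num)) (z + (0 : ℝ) • w)).hasFDerivAt.comp_hasDerivAt 0 (hl 0)
    simpa using! this.clm_apply (hasDerivAt_const (0 : ℝ) w)
  have hcl : ConvexOn ℝ univ (fun t : ℝ => ψ (z + t • w)) := by
    refine ⟨convex_univ, fun a _ b _ s t hs ht hst => ?_⟩
    have := hc.2 (mem_univ (z + a • w)) (mem_univ (z + b • w)) hs ht hst
    obtain rfl : t = 1 - s := by linarith
    have e : z + (s • a + (1 - s) • b) • w = s • (z + a • w) + (1 - s) • (z + b • w) := by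
      simp only [smul_eq_mul]
      module
    simpa only [e] using this
  have hmono : Monotone (fun t : ℝ => fderiv ℝ ψ (z + t • w) w) := by
    have := hcl.monotoneOn_deriv (fun x _ => (h1 x).differentiableAt)
    have e : deriv (fun t : ℝ => ψ (z + t • w)) = fun t : ℝ => fderiv ℝ ψ (z + t • w) w :=
      funext fun t => (h1 t).deriv
    rw [e] at this
    exact monotoneOn_univ.1 this
  have := hmono.deriv_nonneg (x := 0)
  rw [h2.deriv] at this
  simpa using this

section

variable {E : Type*} [NormedAddCommGroup E] [InnerProductSpace ℝ E]

open scoped NNReal Convolution in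
/-- Mollification of a convex Lipschitz function. -/
theorem exists_contDiff_convex_approx [FiniteDimensional ℝ E] {u : E → ℝ} {K : ℝ≥0}
    (hconv : ConvexOn ℝ univ u) (hlip : LipschitzWith K u) {δ : ℝ} (hδ : 0 < δ) :
    ∃ ψ : E → ℝ, ContDiff ℝ 2 ψ ∧ ConvexOn ℝ univ ψ ∧
      (∃ L : ℝ, ∀ z, ‖fderiv ℝ (fderiv ℝ ψ) z‖ ≤ L) ∧
      (∀ z a, (∀ w ∈ Metric.ball z δ, u w ≤ a) → ψ z ≤ a) ∧
      (∀ z a, (∀ w ∈ Metric.ball z δ, a ≤ u w) → a ≤ ψ z) := by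
  let _ : MeasurableSpace E := borel E
  have : BorelSpace E := ⟨rfl⟩
  let b : ContDiffBump (0 : E) := ⟨δ / 2, δ, by linarith, by linarith⟩
  set μ : Measure E := volume
  set B := ContinuousLinearMap.lsmul ℝ ℝ (E := ℝ) with hB
  have hbc : ContDiff ℝ 2 (b.normed μ) := b.contDiff_normed
  have hbs : HasCompactSupport (b.normed μ) := b.hasCompactSupport_normed
  have hul : LocallyIntegrable u μ := hlip.continuous.locallyIntegrable
  have hex : ∀ z, Integrable (fun t => b.normed μ t * u (z - t)) μ := fun x =>
    hbs.convolutionExists_left B hbc.continuous hul x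
  have hval : ∀ z, (b.normed μ ⋆[B, μ] u) z = ∫ t, b.normed μ t * u (z - t) ∂μ := fun z => rfl
  have hbi : Integrable (b.normed μ) μ := b.integrable_normed
  refine ⟨b.normed μ ⋆[B, μ] u, hbs.contDiff_convolution_left B hbc hul, ?_, ?_, ?_, ?_⟩
  · refine ⟨convex_univ, fun x _ y _ s t hs ht hst => ?_⟩
    simp only [hval, smul_eq_mul]
    rw [← integral_const_mul, ← integral_const_mul,
      ← integral_add ((hex x).const_mul s) ((hex y).const_mul t)]
    refine integral_mono (hex _) (((hex x).const_mul s).add ((hex y).const_mul t)) fun r => ?_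
    have h := hconv.2 (mem_univ (x - r)) (mem_univ (y - r)) hs ht hst
    have e : s • (x - r) + t • (y - r) = s • x + t • y - r := by
      have : r = s • r + t • r := by rw [← add_smul, hst, one_smul]
      conv_rhs => rw [this]
      module
    rw [e] at h
    simp only [smul_eq_mul] at h
    have := mul_le_mul_of_nonneg_left h (b.nonneg_normed (μ := μ) r)
    simp only
    linarith
  -- One derivative falls on the bump; the other is controlled by the Lipschitz constant of `u`. No
  -- bound on `u` itself is needed.
  · have hd : fderiv ℝ (b.normed μ ⋆[B, μ] u) = fderiv ℝ (b.normed μ) ⋆[B.precompL E, μ] u :=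
      funext fun z => (hbs.hasFDerivAt_convolution_left B (hbc.of_le (by norm_num)) hul z).fderiv
    obtain ⟨L, hL⟩ := LipschitzWith.convolution_right (μ := μ) (B.precompL E)
      (hbc.continuous_fderiv (by norm_num)) (hbs.fderiv ℝ) hlip
    refine ⟨L, fun z => ?_⟩
    rw [hd]
    exact norm_fderiv_le_of_lipschitz ℝ hL
  · intro z a h
    rw [hval]
    calc ∫ t, b.normed μ t * u (z - t) ∂μ ≤ ∫ t, b.normed μ t * a ∂μ := by
          refine integral_mono (hex z) (hbi.mul_const a) fun t => ?_
          simp only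
          by_cases ht : t ∈ Metric.ball (0 : E) δ
          · refine mul_le_mul_of_nonneg_left (h _ ?_) (b.nonneg_normed t)
            simpa [Metric.mem_ball, dist_eq_norm] using ht
          · have : b.normed μ t = 0 := by
              rw [← Function.notMem_support, b.support_normed_eq]
              exact ht
            simp [this]
      _ = a := by rw [integral_mul_const, b.integral_normed, one_mul]
  · intro z a h
    rw [hval]
    calc a = ∫ t, b.normed μ t * a ∂μ := by rw [integral_mul_const, b.integral_normed, one_mul]
      _ ≤ _ := by
          refine integral_mono (hbi.mul_const a) (hex z) fun t => ?_
          simp only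
          by_cases ht : t ∈ Metric.ball (0 : E) δ
          · refine mul_le_mul_of_nonneg_left (h _ ?_) (b.nonneg_normed t)
            simpa [Metric.mem_ball, dist_eq_norm] using ht
          · have : b.normed μ t = 0 := by
              rw [← Function.notMem_support, b.support_normed_eq]
              exact ht
            simp [this]

/-- Two-sided pointwise control of a function `f` with `f 0 = 1`: Lipschitz from below at the
origin and exponentially decaying. -/
structure HasRadialControl (A c : ℝ) (f : E → ℝ) : Prop where
  nonneg : ∀ z, 0 ≤ f z
  le_one : ∀ z, f z ≤ 1
  one_sub_le : ∀ z, 1 - f z ≤ A * ‖z‖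
  le_exp : ∀ z, f z ≤ A * Real.exp (-c * ‖z‖)

theorem HasRadialControl.apply_zero {A c : ℝ} {f : E → ℝ} (hf : HasRadialControl A c f) : f 0 = 1 :=
  le_antisymm (hf.le_one 0) (by simpa using hf.one_sub_le 0)

theorem HasRadialControl.one_le {A c : ℝ} {f : E → ℝ} (hf : HasRadialControl A c f) : 1 ≤ A := by
  have := hf.le_exp 0
  rw [hf.apply_zero] at this
  simpa using this

theorem HasRadialControl.norm_ray_le {A c : ℝ} {f : E → ℝ} (hf : HasRadialControl A c f) (x : E)
    (p : ℝ) {r : ℝ} (hr : 0 < r) :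
    ‖r ^ (p - 1) * (f (r • x) - if p < 0 then 1 else 0)‖ ≤
      rayBound p (A * max 1 ‖x‖) (c * ‖x‖) r := by
  have hA : 0 ≤ A := zero_le_one.trans hf.one_le
  refine norm_le_rayBound hr (hf.nonneg _) (hf.le_one _) ?_ ?_
  · refine (hf.one_sub_le _).trans ?_
    rw [norm_smul, Real.norm_of_nonneg hr.le]
    have := le_max_right 1 ‖x‖
    calc A * (r * ‖x‖) = A * ‖x‖ * r := by ring
      _ ≤ _ := by gcongr
  · refine (hf.le_exp _).trans ?_
    rw [norm_smul, Real.norm_of_nonneg hr.le]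
    calc A * Real.exp (-c * (r * ‖x‖)) = A * 1 * Real.exp (-(c * ‖x‖) * r) := by ring_nf
      _ ≤ _ := by gcongr; exact le_max_left _ _

theorem HasRadialControl.integrableOn_ray {A c p : ℝ} {f : E → ℝ} (hf : HasRadialControl A c f)
    (hp : -1 < p) (hp0 : p ≠ 0) (hc : 0 < c) {x : E} (hx : x ≠ 0)
    (hm : AEStronglyMeasurable (fun r : ℝ => f (r • x)) (volume.restrict (Ioi 0))) :
    IntegrableOn (fun r : ℝ => r ^ (p - 1) * (f (r • x) - if p < 0 then 1 else 0)) (Ioi 0) := by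
  have hA : 0 ≤ A := zero_le_one.trans hf.one_le
  refine Integrable.mono' (integrableOn_rayBound hp hp0 (by positivity)
    (mul_pos hc (norm_pos_iff.2 hx))) ?_ ((ae_restrict_iff' measurableSet_Ioi).2
      (ae_of_all _ fun r hr => hf.norm_ray_le x p hr))
  exact (ContinuousOn.aestronglyMeasurable (fun r hr =>
    (Real.continuousAt_rpow_const _ _ (Or.inl (ne_of_gt hr))).continuousWithinAt)
    measurableSet_Ioi).mul (hm.sub aestronglyMeasurable_const)

/-- Since `A` and `c` do not depend on the index, a single `rayBound` dominates the whole sequence.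
-/
theorem tendsto_rayMoment {p A c : ℝ} (hp : -1 < p) (hp0 : p ≠ 0) (hc : 0 < c) {f : E → ℝ}
    {F : ℕ → E → ℝ} (hF : ∀ n, HasRadialControl A c (F n)) (hcont : ∀ n, Continuous (F n))
    (hlim : ∀ z, Tendsto (fun n => F n z) atTop (𝓝 (f z))) {x : E} (hx : x ≠ 0) :
    Tendsto (fun n => rayMoment p (F n) x) atTop (𝓝 (rayMoment p f x)) := by
  have hA : 0 ≤ A := zero_le_one.trans (hF 0).one_le
  refine tendsto_integral_of_dominated_convergence _ (fun n => ?_)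
    (integrableOn_rayBound (A := A * max 1 ‖x‖) hp hp0 (by positivity)
      (mul_pos hc (norm_pos_iff.2 hx)))
    (fun n => (ae_restrict_iff' measurableSet_Ioi).2
      (ae_of_all _ fun r hr => (hF n).norm_ray_le x p hr)) (ae_of_all _ fun r => ?_)
  · have := hcont n
    exact ((hF n).integrableOn_ray hp hp0 hc hx
      (by fun_prop : Continuous _).aestronglyMeasurable).aestronglyMeasurable
  · exact ((hlim _).sub_const _).const_mul _

end

/-! ### Smooth approximation of log-concave functions by inf-convolution. -/

section

variable {E : Type*} [NormedAddCommGroup E] [InnerProductSpace ℝ E]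

/-- Log-concavity in multiplicative form, on an arbitrary real vector space. -/
def LogConcave (f : E → ℝ) : Prop :=
  ∀ l : ℝ, 0 < l → l < 1 → ∀ x y : E, 0 < f x → 0 < f y →
    f x ^ (1 - l) * f y ^ l ≤ f ((1 - l) • x + l • y)

/-- Inf-convolution of `-log f` with `k * ‖·‖`. -/
noncomputable def lipEnvelope (f : E → ℝ) (k : ℝ) (z : E) : ℝ :=
  ⨅ w : {w // 0 < f w}, (-Real.log (f w) + k * ‖z - w‖)

variable {f : E → ℝ} {A c k : ℝ}

theorem HasRadialControl.le_lipEnvelope (hf : HasRadialControl A c f) {a : ℝ} {z : E}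
    (h : ∀ w, 0 < f w → a ≤ -Real.log (f w) + k * ‖z - w‖) : a ≤ lipEnvelope f k z := by
  have : Nonempty {w // 0 < f w} := ⟨⟨0, by rw [hf.apply_zero]; exact one_pos⟩⟩
  exact le_ciInf fun w => h w w.2

theorem HasRadialControl.lipEnvelope_le (hf : HasRadialControl A c f) (hk : 0 ≤ k) (z : E) {w : E}
    (hw : 0 < f w) : lipEnvelope f k z ≤ -Real.log (f w) + k * ‖z - w‖ := by
  refine ciInf_le (f := fun w : {w // 0 < f w} => -Real.log (f w) + k * ‖z - w‖) ⟨0, ?_⟩ ⟨w, hw⟩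
  rintro _ ⟨w, rfl⟩
  have := Real.log_nonpos (hf.nonneg w) (hf.le_one w)
  have : 0 ≤ k * ‖z - w‖ := by positivity
  simp only
  linarith

theorem HasRadialControl.lipEnvelope_nonneg (hf : HasRadialControl A c f) (hk : 0 ≤ k) (z : E) :
    0 ≤ lipEnvelope f k z :=
  hf.le_lipEnvelope fun w _ => by
    have := Real.log_nonpos (hf.nonneg w) (hf.le_one w)
    have : 0 ≤ k * ‖z - w‖ := by positivity
    linarith

theorem HasRadialControl.lipEnvelope_zero (hf : HasRadialControl A c f) (hk : 0 ≤ k) :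
    lipEnvelope f k 0 = 0 := by
  refine le_antisymm ?_ (hf.lipEnvelope_nonneg hk 0)
  have := hf.lipEnvelope_le hk 0 (w := 0) (by rw [hf.apply_zero]; exact one_pos)
  simpa [hf.apply_zero] using this

theorem HasRadialControl.lipEnvelope_sub_le (hf : HasRadialControl A c f) (hk : 0 ≤ k) (z z' : E) :
    lipEnvelope f k z ≤ lipEnvelope f k z' + k * ‖z - z'‖ := by
  rw [← sub_le_iff_le_add]
  refine hf.le_lipEnvelope fun w hw => ?_
  have h1 := hf.lipEnvelope_le hk z hw
  have h2 : k * ‖z - w‖ ≤ k * (‖z - z'‖ + ‖z' - w‖) := by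
    gcongr
    exact norm_sub_le_norm_sub_add_norm_sub z z' w
  linarith

/-- This is partial minimization of the jointly convex function `-log f(w) + k‖z - w‖` of `(z, w)`.
Near-minimizers are used, as the infimum need not be attained. -/
theorem HasRadialControl.convexOn_lipEnvelope (hf : HasRadialControl A c f) (hlc : LogConcave f)
    (hk : 0 ≤ k) : ConvexOn ℝ univ (lipEnvelope f k) := by
  have hne : Nonempty {w // 0 < f w} := ⟨⟨0, by rw [hf.apply_zero]; exact one_pos⟩⟩
  refine convexOn_iff_forall_pos.2 ⟨convex_univ, fun x _ y _ s t hs ht hst => ?_⟩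
  simp only [smul_eq_mul]
  refine le_of_forall_pos_le_add fun η hη => ?_
  obtain ⟨⟨w, hw⟩, h1⟩ := exists_lt_of_ciInf_lt
    (show (⨅ w : {w // 0 < f w}, (-Real.log (f w) + k * ‖x - w‖)) < lipEnvelope f k x + η by
      unfold lipEnvelope; linarith)
  obtain ⟨⟨w', hw'⟩, h2⟩ := exists_lt_of_ciInf_lt
    (show (⨅ w : {w // 0 < f w}, (-Real.log (f w) + k * ‖y - w‖)) < lipEnvelope f k y + η by
      unfold lipEnvelope; linarith)
  simp only at h1 h2
  obtain rfl : s = 1 - t := by linarith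
  have h3 := hlc t ht (by linarith) w w' hw hw'
  have h4 : 0 < f w ^ (1 - t) * f w' ^ t := by positivity
  have h5 : (1 - t) * Real.log (f w) + t * Real.log (f w') ≤
      Real.log (f ((1 - t) • w + t • w')) := by
    have := Real.log_le_log h4 h3
    rwa [Real.log_mul (Real.rpow_pos_of_pos hw _).ne' (Real.rpow_pos_of_pos hw' _).ne',
      Real.log_rpow hw, Real.log_rpow hw'] at this
  have h6 := hf.lipEnvelope_le hk ((1 - t) • x + t • y) (h4.trans_le h3)
  have h7 : ‖(1 - t) • x + t • y - ((1 - t) • w + t • w')‖ ≤ (1 - t) * ‖x - w‖ + t * ‖y - w'‖ := by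
    have e : (1 - t) • x + t • y - ((1 - t) • w + t • w') = (1 - t) • (x - w) + t • (y - w') := by
      module
    rw [e]
    refine (norm_add_le _ _).trans_eq ?_
    rw [norm_smul, norm_smul, Real.norm_of_nonneg hs.le, Real.norm_of_nonneg ht.le]
  have h8 := mul_le_mul_of_nonneg_left h7 hk
  have h9 := mul_le_mul_of_nonneg_left h1.le hs.le
  have h10 := mul_le_mul_of_nonneg_left h2.le ht.le
  linarith

/-- The choice `w = z` bounds the limit below by `f z`. From above, semicontinuity handles `w`
within `δ` of `z`, and the penalty handles all other `w` once `κ n * δ ≥ -log a'`. -/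
theorem HasRadialControl.tendsto_exp_neg_lipEnvelope (hf : HasRadialControl A c f)
    (husc : UpperSemicontinuous f) (z : E) {κ : ℕ → ℝ} (hκ0 : ∀ n, 0 ≤ κ n)
    (hκ : Tendsto κ atTop atTop) :
    Tendsto (fun n => Real.exp (-lipEnvelope f (κ n) z)) atTop (𝓝 (f z)) := by
  refine tendsto_order.2 ⟨fun a ha => Eventually.of_forall fun n => ?_, fun a ha => ?_⟩
  · rcases (hf.nonneg z).eq_or_lt with h0 | h0
    · exact (ha.trans_eq h0.symm).trans (Real.exp_pos _)
    · refine ha.trans_le ?_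
      have h := hf.lipEnvelope_le (hκ0 n) z h0
      rw [sub_self, norm_zero, mul_zero, add_zero] at h
      rw [← Real.exp_log h0]
      exact Real.exp_le_exp.2 (by linarith)
  · obtain ⟨a', ha', haa'⟩ := exists_between ha
    have ha'0 : 0 < a' := (hf.nonneg z).trans_lt ha'
    obtain ⟨δ, hδ, hball⟩ := Metric.eventually_nhds_iff.1 (husc z a' ha')
    filter_upwards [hκ.eventually_ge_atTop (-Real.log a' / δ)] with n hn
    have h1 : -Real.log a' ≤ lipEnvelope f (κ n) z := by
      refine hf.le_lipEnvelope fun w hw => ?_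
      have h2 := Real.log_nonpos (hf.nonneg w) (hf.le_one w)
      have h3 : 0 ≤ κ n * ‖z - w‖ := mul_nonneg (hκ0 n) (norm_nonneg _)
      rcases lt_or_ge (dist w z) δ with h | h
      · have := Real.log_le_log hw (hball h).le
        linarith
      · rw [dist_comm, dist_eq_norm] at h
        have : κ n * δ ≤ κ n * ‖z - w‖ := mul_le_mul_of_nonneg_left h (hκ0 n)
        rw [div_le_iff₀ hδ] at hn
        linarith
    calc Real.exp (-lipEnvelope f (κ n) z) ≤ Real.exp (Real.log a') :=
          Real.exp_le_exp.2 (by linarith)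
      _ = a' := Real.exp_log ha'0
      _ < a := haa'

/-- The bound on `s` is needed only where `B * t ≤ 1`, the claim about `exp (-s)` being trivial
elsewhere. The quadratic term costs the extra `1`, by `min 1 (t²) ≤ t`. -/
theorem one_sub_exp_neg_add_sq_le {B s q t : ℝ} (ht : 0 ≤ t) (hs0 : 0 ≤ s)
    (hs : B * t ≤ 1 → s ≤ B * t) (hq0 : 0 ≤ q) (hq : q ≤ t ^ 2) :
    1 - Real.exp (-(s + q)) ≤ (B + 1) * t := by
  have h1 : 1 - Real.exp (-s) ≤ B * t := by
    rcases le_total (B * t) 1 with h | h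
    · linarith [hs h, Real.add_one_le_exp (-s)]
    · linarith [Real.exp_pos (-s)]
  have h2 : 1 - Real.exp (-q) ≤ t := by
    rcases le_total t 1 with h | h
    · nlinarith [Real.add_one_le_exp (-q)]
    · linarith [Real.exp_pos (-q)]
  have h3 : Real.exp (-s) ≤ 1 := Real.exp_le_one_iff.2 (by linarith)
  have h4 : Real.exp (-q) ≤ 1 := Real.exp_le_one_iff.2 (by linarith)
  have h5 : Real.exp (-(s + q)) = Real.exp (-s) * Real.exp (-q) := by
    rw [← Real.exp_add]; congr 1; ring
  rw [h5]
  nlinarith [mul_nonneg (sub_nonneg.2 h3) (sub_nonneg.2 h4)]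

/-- A smooth, uniformly convex function approximating `-log f`. -/
theorem HasRadialControl.exists_smooth_approx [FiniteDimensional ℝ E] (hf : HasRadialControl A c f)
    (hlc : LogConcave f) (hc : 0 < c) (hc1 : c ≤ 1) (k : ℝ) (hk : 1 ≤ k) :
    ∃ φ : E → ℝ, ContDiff ℝ 2 φ ∧ φ 0 = 0 ∧ fderiv ℝ φ 0 = 0 ∧
      (∀ z w, 1 / k * ‖w‖ ^ 2 ≤ fderiv ℝ (fderiv ℝ φ) z w w) ∧
      (∃ L : ℝ, ∀ z, ‖fderiv ℝ (fderiv ℝ φ) z‖ ≤ L) ∧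
      HasRadialControl (4 * A + 1 + A * Real.exp 2) c (fun z => Real.exp (-φ z)) ∧
      ∀ z, |φ z - lipEnvelope f k z| ≤ (2 + ‖z‖ ^ 2) / k := by
  have hk0 : 0 < k := by linarith
  have hA := hf.one_le
  set e := lipEnvelope f k with he
  -- Truncation makes `u` vanish near the origin, so mollifying preserves the value `0` and the
  -- critical point there.
  set u : E → ℝ := fun z => max (e z - 1 / k) 0 with hu
  have heconv := hf.convexOn_lipEnvelope hlc hk0.le
  have huconv : ConvexOn ℝ univ u :=
    (heconv.sub (concaveOn_const _ convex_univ)).sup (convexOn_const 0 convex_univ)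
  have hunn : ∀ z, 0 ≤ u z := fun z => le_max_right _ _
  have hule : ∀ z, u z ≤ e z := fun z => max_le (by
    have : 0 < 1 / k := by positivity
    linarith) (hf.lipEnvelope_nonneg hk0.le z)
  have hleu : ∀ z, e z - 1 / k ≤ u z := fun z => le_max_left _ _
  have hulip' : ∀ z z', u z ≤ u z' + k * ‖z - z'‖ := fun z z' => by
    have h1 := hf.lipEnvelope_sub_le hk0.le z z'
    have h2 := hleu z'
    have h3 := hunn z'
    have : 0 ≤ k * ‖z - z'‖ := by positivity
    exact max_le (by linarith) (by linarith)
  have hulip : LipschitzWith k.toNNReal u := by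
    refine LipschitzWith.of_dist_le_mul fun z z' => ?_
    rw [Real.coe_toNNReal _ hk0.le, Real.dist_eq, dist_eq_norm, abs_le]
    have h1 := hulip' z z'
    have h2 := hulip' z' z
    rw [norm_sub_rev] at h2
    constructor <;> linarith
  -- With `k * (2 * δ) = 1 / k`, the `k`-Lipschitz function `e` stays below `1 / k` on the
  -- `2δ`-ball. Hence `u` vanishes there and its mollification `ψ` on the `δ`-ball.
  set δ : ℝ := 1 / (2 * k ^ 2) with hδ
  have hδ0 : 0 < δ := by positivity
  have hkδ : k * δ = 1 / (2 * k) := by rw [hδ]; field_simp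
  have hδ1 : δ ≤ 1 := by
    rw [hδ, div_le_one (by positivity)]; nlinarith
  obtain ⟨ψ, hψ, hψc, ⟨L, hL⟩, hψle, hleψ⟩ := exists_contDiff_convex_approx huconv hulip hδ0
  have hψnn : ∀ z, 0 ≤ ψ z := fun z => hleψ z 0 fun w _ => hunn w
  have huzero : ∀ w ∈ Metric.ball (0 : E) (2 * δ), u w = 0 := by
    intro w hw
    rw [mem_ball_zero_iff] at hw
    refine max_eq_right ?_
    have h1 := hf.lipEnvelope_sub_le hk0.le w 0
    rw [hf.lipEnvelope_zero hk0.le, sub_zero] at h1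
    have h2 : k * ‖w‖ ≤ k * (2 * δ) := by gcongr
    have h3 : k * (2 * δ) = 1 / k := by rw [hδ]; field_simp
    linarith
  have hψzero : ∀ z ∈ Metric.ball (0 : E) δ, ψ z = 0 := by
    intro z hz
    refine le_antisymm (hψle z 0 fun w hw => (huzero w ?_).le) (hψnn z)
    rw [Metric.mem_ball] at *
    linarith [dist_triangle w z 0]
  have hψ0 : ψ =ᶠ[𝓝 0] fun _ => 0 := by
    filter_upwards [Metric.ball_mem_nhds (0 : E) hδ0] with z hz using hψzero z hz
  have hψd0 : fderiv ℝ ψ 0 = 0 := by rw [hψ0.fderiv_eq]; simp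
  have hψu : ∀ z, |ψ z - u z| ≤ 1 / (2 * k) := by
    intro z
    rw [← hkδ, abs_le]
    constructor
    · have := hleψ z (u z - k * δ) fun w hw => by
        have h1 := hulip' z w
        rw [Metric.mem_ball, dist_comm, dist_eq_norm] at hw
        have : k * ‖z - w‖ ≤ k * δ := by gcongr
        linarith
      linarith
    · have := hψle z (u z + k * δ) fun w hw => by
        have h1 := hulip' w z
        rw [Metric.mem_ball, dist_eq_norm] at hw
        have : k * ‖w - z‖ ≤ k * δ := by gcongr
        linarith
      linarith
  have hq : ContDiff ℝ 2 (fun z : E => ‖z‖ ^ 2) := contDiff_norm_sq ℝ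
  have hψdiff : Differentiable ℝ ψ := hψ.differentiable (by norm_num)
  have hψ1 : Differentiable ℝ (fderiv ℝ ψ) :=
    (hψ.fderiv_right (m := 1) (by norm_num)).differentiable (by norm_num)
  set I : E →L[ℝ] E →L[ℝ] ℝ := innerSL ℝ with hI
  have hd1 : fderiv ℝ (fun z => ψ z + 1 / k * ‖z‖ ^ 2) =
      fun z => fderiv ℝ ψ z + (2 / k) • I z := by
    funext z
    rw [fderiv_fun_add (hψdiff z) ((hq.differentiable (by norm_num) z).const_mul _),
      fderiv_const_mul (hq.differentiable (by norm_num) z), fderiv_norm_sq_apply]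
    ext w
    have h2 : I z w = inner ℝ z w := innerSL_apply_apply ℝ z w
    simp [h2]
    ring
  have hd2 : ∀ z, fderiv ℝ (fderiv ℝ (fun z => ψ z + 1 / k * ‖z‖ ^ 2)) z =
      fderiv ℝ (fderiv ℝ ψ) z + (2 / k) • I := by
    intro z
    have h : HasFDerivAt (fun z : E => (2 / k) • I z) ((2 / k) • I) z :=
      ((2 / k) • I).hasFDerivAt
    rw [hd1]
    exact ((hψ1 z).hasFDerivAt.add h).fderiv
  refine ⟨fun z => ψ z + 1 / k * ‖z‖ ^ 2, hψ.add (contDiff_const.mul hq), ?_, ?_, ?_, ?_, ?_, ?_⟩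
  · simp [hψzero 0 (Metric.mem_ball_self hδ0)]
  · rw [hd1]
    simp [hψd0]
  · intro z w
    rw [hd2]
    have h1 := ConvexOn.fderiv_fderiv_nonneg hψ hψc z w
    have h2 : I w w = ‖w‖ ^ 2 := by rw [hI, innerSL_apply_apply, real_inner_self_eq_norm_sq]
    simp only [add_apply, smul_apply, smul_eq_mul, h2]
    have h3 : 0 ≤ 1 / k * ‖w‖ ^ 2 := by positivity
    have h4 : 2 / k * ‖w‖ ^ 2 = 2 * (1 / k * ‖w‖ ^ 2) := by ring
    linarith
  · refine ⟨L + ‖(2 / k) • I‖, fun z => ?_⟩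
    rw [hd2]
    exact (norm_add_le (fderiv ℝ (fderiv ℝ ψ) z) _).trans (by gcongr; exact hL z)
  · have hq0 : ∀ z : E, 0 ≤ 1 / k * ‖z‖ ^ 2 := fun z => by positivity
    refine ⟨fun z => (Real.exp_pos _).le, fun z => Real.exp_le_one_iff.2 ?_, fun z => ?_, fun z => ?_⟩
    · linarith [hψnn z, hq0 z]
    -- The `4` in `4 * A` is two factors of `2`: one from `‖w‖ ≤ 2‖z‖`, one from `-log s ≤ 2 (1 -
    -- s)` for `s ≥ 1/2`.
    · refine (one_sub_exp_neg_add_sq_le (B := 4 * A) (norm_nonneg z) (hψnn z)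
        (fun h => ?_) (hq0 z) ?_).trans ?_
      · rcases lt_or_ge ‖z‖ δ with hz | hz
        · rw [hψzero z (by simpa using hz)]
          positivity
        · refine hψle z _ fun w hw => (hule w).trans ?_
          have hwz : ‖w‖ ≤ 2 * ‖z‖ := by
            rw [Metric.mem_ball, dist_eq_norm] at hw
            have := norm_le_norm_add_norm_sub z w
            rw [norm_sub_rev] at this
            linarith
          have h1 : 1 - f w ≤ 2 * A * ‖z‖ := (hf.one_sub_le w).trans (by
            calc A * ‖w‖ ≤ A * (2 * ‖z‖) := by gcongr
              _ = _ := by ring)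
          have hfw : 1 / 2 ≤ f w := by linarith
          have h2 := hf.lipEnvelope_le hk0.le w (w := w) (by linarith)
          rw [sub_self, norm_zero, mul_zero, add_zero] at h2
          refine h2.trans ?_
          have h3 := Real.one_sub_inv_le_log_of_pos (show 0 < f w by linarith)
          have h4 : (f w)⁻¹ - 1 ≤ 2 * (1 - f w) := by
            rw [inv_eq_one_div, sub_le_iff_le_add, div_le_iff₀ (by linarith)]
            nlinarith [hf.le_one w]
          linarith
      · have : 1 / k ≤ 1 := by rw [div_le_one hk0]; exact hk
        calc 1 / k * ‖z‖ ^ 2 ≤ 1 * ‖z‖ ^ 2 := by gcongr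
          _ = _ := one_mul _
      · have : 0 ≤ A * Real.exp 2 := by positivity
        exact mul_le_mul_of_nonneg_right (by linarith) (norm_nonneg z)
    -- The loss `2` pays for the truncation, `1 / k ≤ 1`, and for the mollification radius, `c * δ ≤
    -- 1`.
    · have h1 : -Real.log A + c * ‖z‖ - 2 ≤ ψ z := by
        refine hleψ z _ fun w hw => ?_
        refine le_trans ?_ (hleu w)
        have h2 : -Real.log A + c * ‖w‖ ≤ e w := by
          refine hf.le_lipEnvelope fun w' hw' => ?_
          have h3 := Real.log_le_log hw' (hf.le_exp w')
          rw [Real.log_mul (by linarith) (Real.exp_pos _).ne', Real.log_exp] at h3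
          have h4 : c * ‖w‖ ≤ c * (‖w - w'‖ + ‖w'‖) := by
            gcongr
            simpa using norm_add_le (w - w') w'
          have h5 : c * ‖w - w'‖ ≤ k * ‖w - w'‖ := by gcongr; linarith
          linarith
        have h6 : c * ‖z‖ ≤ c * (‖w‖ + δ) := by
          rw [Metric.mem_ball, dist_comm, dist_eq_norm] at hw
          gcongr
          have := norm_add_le (z - w) w
          rw [sub_add_cancel] at this
          linarith
        have h7 : c * δ ≤ 1 := by nlinarith
        have h8 : 1 / k ≤ 1 := by rw [div_le_one hk0]; exact hk
        linarith
      calc Real.exp (-(ψ z + 1 / k * ‖z‖ ^ 2)) ≤ Real.exp (Real.log A + 2 + -c * ‖z‖) :=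
            Real.exp_le_exp.2 (by linarith [hq0 z])
        _ = A * Real.exp 2 * Real.exp (-c * ‖z‖) := by
            rw [Real.exp_add, Real.exp_add, Real.exp_log (by linarith)]
        _ ≤ _ := by
            gcongr
            linarith
  · intro z
    have h1 := abs_le.1 (hψu z)
    have h2 := hule z
    have h3 := hleu z
    have h4 : 1 / (2 * k) = 1 / k / 2 := by field_simp
    have h5 : 0 < 1 / k := by positivity
    have h6 : (2 + ‖z‖ ^ 2) / k = 2 * (1 / k) + 1 / k * ‖z‖ ^ 2 := by ring
    have h7 : 0 ≤ 1 / k * ‖z‖ ^ 2 := by positivity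
    rw [h4] at h1
    rw [h6, abs_le]
    constructor <;> linarith

theorem HasRadialControl.rayMoment_quasiconcave [FiniteDimensional ℝ E] {p : ℝ} (hp : -1 < p)
    (hp0 : p ≠ 0) (hf : HasRadialControl A c f) (hlc : LogConcave f)
    (husc : UpperSemicontinuous f) (hc : 0 < c) {x v : E}
    (hind : ∀ a b : ℝ, a • x + b • v = 0 → a = 0 ∧ b = 0) {t : ℝ} (ht : t ∈ Icc (0 : ℝ) 1) :
    min (rayMoment p f x) (rayMoment p f (x + v)) ≤ rayMoment p f (x + t • v) := by
  have hA := hf.one_le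
  -- Lowering the rate to at most `1` keeps it below every Lipschitz constant `n + 1`, so the
  -- approximants inherit this decay rate.
  have hf' : HasRadialControl A (min c 1) f := ⟨hf.nonneg, hf.le_one, hf.one_sub_le, fun z =>
    (hf.le_exp z).trans (by
      gcongr
      exact min_le_left _ _)⟩
  have hc' : 0 < min c 1 := lt_min hc one_pos
  have hκ1 : ∀ n : ℕ, (1 : ℝ) ≤ n + 1 := fun n => by linarith [n.cast_nonneg (α := ℝ)]
  choose φ hφ h0 hd0 hlow hup hrad happ using fun n : ℕ =>
    hf'.exists_smooth_approx hlc hc' (min_le_right _ _) (n + 1) (hκ1 n)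
  have hκ : Tendsto (fun n : ℕ => (n : ℝ) + 1) atTop atTop :=
    tendsto_atTop_add_const_right _ _ tendsto_natCast_atTop_atTop
  have hlim : ∀ z, Tendsto (fun n => Real.exp (-φ n z)) atTop (𝓝 (f z)) := by
    intro z
    have h1 := hf.tendsto_exp_neg_lipEnvelope husc z
      (fun n : ℕ => (zero_le_one.trans (hκ1 n))) hκ
    have h2 : Tendsto (fun n : ℕ => φ n z - lipEnvelope f (n + 1) z) atTop (𝓝 0) :=
      squeeze_zero_norm (fun n => happ n z) (tendsto_const_nhds.div_atTop hκ)
    have h3 := h1.mul ((Real.continuous_exp.tendsto _).comp h2.neg)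
    simp only [neg_zero, Real.exp_zero, mul_one] at h3
    refine h3.congr fun n => ?_
    simp only [Function.comp]
    rw [← Real.exp_add]
    congr 1
    ring
  have hne : ∀ y : ℝ, x + y • v ≠ 0 := fun y h => by
    have := (hind 1 y (by rw [one_smul]; exact h)).1
    exact one_ne_zero this
  have hT : ∀ y : ℝ, Tendsto (fun n => rayMoment p (fun z => Real.exp (-φ n z)) (x + y • v)) atTop
      (𝓝 (rayMoment p f (x + y • v))) := fun y =>
    tendsto_rayMoment hp hp0 hc' hrad
      (fun n => Real.continuous_exp.comp (hφ n).continuous.neg) hlim (hne y)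
  have hT0 := hT 0
  have hT1 := hT 1
  rw [zero_smul, add_zero] at hT0
  rw [one_smul] at hT1
  refine le_of_tendsto_of_tendsto' (hT0.min hT1) (hT t) fun n => ?_
  obtain ⟨L, hL⟩ := hup n
  exact rayMoment_quasiconcave_of_smooth hp hp0 (by have := hκ1 n; positivity) (hφ n) (h0 n) (hd0 n)
    (hlow n) hL hind ht

end

/-! ### Linear bound at the origin and exponential decay for `g` in `LC_n^0`. -/

/-- A packing argument: if `z ∈ C` were too far away, `m` disjoint balls of radius `ρ / 2` centred
on the first half of the segment from `0` to `z` would fit in `C` by convexity and exceed its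
volume. -/
theorem Convex.exists_norm_le_of_volume_ne_top {n : ℕ} {C : Set (EuclideanSpace ℝ (Fin n))}
    (hC : Convex ℝ C) {ρ : ℝ} (hρ : 0 < ρ) (hball : Metric.ball 0 ρ ⊆ C)
    (hvol : volume C ≠ ⊤) : ∃ R : ℝ, ∀ z ∈ C, ‖z‖ ≤ R := by
  have hb0 : volume (Metric.ball (0 : EuclideanSpace ℝ (Fin n)) (ρ / 2)) ≠ 0 :=
    (Metric.measure_ball_pos volume _ (by linarith)).ne'
  obtain ⟨m, hm⟩ := ENNReal.exists_nat_mul_gt hb0 hvol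
  refine ⟨2 * m * ρ, fun z hz => ?_⟩
  by_contra! hlt
  have hm0 : m ≠ 0 := by rintro rfl; simp at hm
  have hmpos : (0 : ℝ) < m := by positivity
  set c : ℕ → EuclideanSpace ℝ (Fin n) := fun i => ((i : ℝ) / (2 * m)) • z with hc
  have hsub : (⋃ i ∈ Finset.range m, Metric.ball (c i) (ρ / 2)) ⊆ C := by
    intro w hw
    simp only [mem_iUnion, Finset.mem_range] at hw
    obtain ⟨i, hi, hw⟩ := hw
    set t : ℝ := (i : ℝ) / (2 * m) with ht
    have ht0 : 0 ≤ t := by positivity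
    have ht1 : t ≤ 1 / 2 := by
      rw [ht, div_le_iff₀ (by positivity)]
      have : (i : ℝ) ≤ m := by exact_mod_cast hi.le
      linarith
    have hu : (1 - t)⁻¹ • (w - c i) ∈ C := by
      refine hball ?_
      rw [mem_ball_zero_iff, norm_smul, Real.norm_of_nonneg (by
        rw [inv_nonneg]; linarith)]
      rw [Metric.mem_ball, dist_eq_norm] at hw
      rw [inv_mul_lt_iff₀ (by linarith)]
      nlinarith
    have := hC hu hz (show 0 ≤ 1 - t by linarith) ht0 (by ring)
    rw [smul_smul, mul_inv_cancel₀ (by linarith), one_smul] at this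
    have e : w - c i + t • z = w := sub_add_cancel _ _
    rwa [e] at this
  have hdisj : (↑(Finset.range m) : Set ℕ).PairwiseDisjoint (fun i => Metric.ball (c i) (ρ / 2)) := by
    intro i _ j _ hij
    refine Metric.ball_disjoint_ball ?_
    rw [dist_eq_norm, hc]
    simp only
    rw [← sub_smul, norm_smul, ← sub_div, norm_div, Real.norm_of_nonneg (by positivity : 0 ≤ 2 * (m : ℝ))]
    have h1 : (1 : ℝ) ≤ ‖(i : ℝ) - j‖ := by
      rw [Real.norm_eq_abs]
      have : (1 : ℤ) ≤ |(i : ℤ) - j| := Int.one_le_abs (by omega)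
      exact_mod_cast this
    have h2 : 1 / (2 * (m : ℝ)) * (2 * m * ρ) ≤ ‖(i : ℝ) - j‖ / (2 * m) * ‖z‖ := by
      gcongr
    have h3 : 1 / (2 * (m : ℝ)) * (2 * m * ρ) = ρ := by field_simp
    linarith
  have h1 : (m : ENNReal) * volume (Metric.ball (0 : EuclideanSpace ℝ (Fin n)) (ρ / 2)) ≤ volume C := by
    refine le_trans (le_of_eq ?_) (measure_mono hsub)
    rw [measure_biUnion_finset hdisj fun i _ => measurableSet_ball]
    simp [Measure.addHaar_ball_center]
  exact absurd hm (not_lt.2 h1)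

namespace IsLC0

variable {n : ℕ} {g : EuclideanSpace ℝ (Fin n) → ℝ}

theorem origin_pos (hg : IsLC0 g) : 0 < g 0 := by
  by_contra! h
  have : ∀ x, g x = 0 := fun x => le_antisymm ((hg.le_origin x).trans h) (hg.nonneg x)
  have h2 := hg.integral_pos
  simp [this] at h2

theorem logConcave' (hg : IsLC0 g) {l : ℝ} (hl0 : 0 < l) (hl1 : l < 1)
    {x y : EuclideanSpace ℝ (Fin n)} (hx : 0 < g x) (hy : 0 < g y) :
    g x ^ (1 - l) * g y ^ l ≤ g ((1 - l) • x + l • y) :=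
  hg.logConcave l hl0 hl1 x y (mul_pos hx hy)

theorem convex_pos (hg : IsLC0 g) : Convex ℝ {x | 0 < g x} := by
  refine convex_iff_forall_pos.2 fun x hx y hy s t hs ht hst => ?_
  obtain rfl : s = 1 - t := by linarith
  have hx : 0 < g x := hx
  have hy : 0 < g y := hy
  have : 0 < g x ^ (1 - t) * g y ^ t := by positivity
  exact this.trans_le (hg.logConcave' ht (by linarith) hx hy)

theorem convexOn_neg_log (hg : IsLC0 g) : ConvexOn ℝ {x | 0 < g x} fun x => -Real.log (g x) := by
  refine convexOn_iff_forall_pos.2 ⟨hg.convex_pos, fun x hx y hy s t hs ht hst => ?_⟩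
  obtain rfl : s = 1 - t := by linarith
  have hx : 0 < g x := hx
  have hy : 0 < g y := hy
  have h1 : 0 < g x ^ (1 - t) * g y ^ t := by positivity
  have h2 := Real.log_le_log h1 (hg.logConcave' ht (by linarith) hx hy)
  rw [Real.log_mul (by positivity) (by positivity), Real.log_rpow hx, Real.log_rpow hy] at h2
  simp only [smul_eq_mul]
  linarith

/-- A convex set has null frontier. If `{g > 0}` had empty interior, its closure would be null, yet
it contains a neighbourhood of `0`. With nonempty interior, set and closure have the same interior.
-/
theorem zero_mem_interior_pos (hg : IsLC0 g) :
    (0 : EuclideanSpace ℝ (Fin n)) ∈ interior {x | 0 < g x} := by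
  have hne : (interior {x | 0 < g x}).Nonempty := by
    by_contra h
    rw [not_nonempty_iff_eq_empty] at h
    have h1 := hg.convex_pos.addHaar_frontier volume
    rw [frontier, h, sdiff_empty] at h1
    have h2 : 0 < volume (interior (supp g)) := isOpen_interior.measure_pos _ ⟨0, hg.origin_mem⟩
    exact absurd (measure_mono_null interior_subset h1) h2.ne'
  have := hg.convex_pos.interior_closure_eq_interior_of_nonempty_interior hne
  rw [← this]
  exact hg.origin_mem

/-- The convex function `-log g` is Lipschitz near `0`, an interior point of its domain, and `1 - s
≤ -log s`. -/
theorem exists_one_sub_le (hg : IsLC0 g) : ∃ ρ > 0, ∃ A : ℝ, ∀ z ∈ Metric.ball 0 ρ,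
    0 < g z ∧ 1 - g z / g 0 ≤ A * ‖z‖ := by
  obtain ⟨K, t, ht, hK⟩ := hg.convexOn_neg_log.locallyLipschitzOn_interior hg.zero_mem_interior_pos
  rw [isOpen_interior.nhdsWithin_eq hg.zero_mem_interior_pos] at ht
  obtain ⟨ρ, hρ, hball⟩ := Metric.mem_nhds_iff.1
    (inter_mem ht (isOpen_interior.mem_nhds hg.zero_mem_interior_pos))
  refine ⟨ρ, hρ, K, fun z hz => ?_⟩
  have hz' := hball hz
  have hgz : 0 < g z := interior_subset (s := {x | 0 < g x}) hz'.2
  refine ⟨hgz, ?_⟩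
  have h1 := hK.dist_le_mul z hz'.1 0 (hball (Metric.mem_ball_self hρ)).1
  rw [dist_zero_right, Real.dist_eq] at h1
  have h2 := (le_abs_self _).trans h1
  have h3 : Real.log (g z / g 0) = Real.log (g z) - Real.log (g 0) :=
    Real.log_div hgz.ne' hg.origin_pos.ne'
  have h4 := Real.log_le_sub_one_of_pos (div_pos hgz hg.origin_pos)
  have h5 : Real.log (g z / g 0) ≤ 0 := by
    refine Real.log_nonpos (div_pos hgz hg.origin_pos).le ?_
    rw [div_le_one hg.origin_pos]; exact hg.le_origin z
  have h6 := Real.add_one_le_exp (Real.log (g z / g 0))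
  rw [Real.exp_log (div_pos hgz hg.origin_pos)] at h6
  linarith

/-- The superlevel set `{g ≥ g 0 / e}` is convex, contains a ball and has finite volume, so it is
bounded. Beyond its radius, log-concavity on the segment from `0` propagates the drop by a factor
`e` into exponential decay. -/
theorem exists_le_exp (hg : IsLC0 g) : ∃ c > 0, ∀ z, g z / g 0 ≤ Real.exp 1 * Real.exp (-c * ‖z‖) := by
  obtain ⟨ρ₀, hρ₀, A, hA⟩ := hg.exists_one_sub_le
  have h0 := hg.origin_pos
  -- a ball on which `g ≥ g 0 / e`
  obtain ⟨ρ, hρ, hball⟩ : ∃ ρ > 0, ∀ z ∈ Metric.ball (0 : EuclideanSpace ℝ (Fin n)) ρ,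
      g 0 * Real.exp (-1) ≤ g z := by
    have he : 0 < 1 - Real.exp (-1) := by
      rw [sub_pos, Real.exp_lt_one_iff]; norm_num
    have hA' : 0 < max A 1 := lt_max_of_lt_right one_pos
    refine ⟨min ρ₀ ((1 - Real.exp (-1)) / max A 1), lt_min hρ₀ (div_pos he hA'), fun z hz => ?_⟩
    rw [mem_ball_zero_iff, lt_min_iff] at hz
    have h1 := (hA z (by simpa using hz.1)).2
    have h2 : A * ‖z‖ ≤ max A 1 * ‖z‖ := by gcongr; exact le_max_left _ _
    have h3 := hz.2
    rw [lt_div_iff₀ hA'] at h3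
    have h4 : Real.exp (-1) ≤ g z / g 0 := by nlinarith
    rw [le_div_iff₀ h0] at h4
    linarith
  have hpos : 0 < g 0 * Real.exp (-1) := by positivity
  have hconv : Convex ℝ {z | g 0 * Real.exp (-1) ≤ g z} := by
    refine convex_iff_forall_pos.2 fun x hx y hy s t hs ht hst => ?_
    obtain rfl : s = 1 - t := by linarith
    have hx : g 0 * Real.exp (-1) ≤ g x := hx
    have hy : g 0 * Real.exp (-1) ≤ g y := hy
    refine le_trans ?_ (hg.logConcave' ht (by linarith) (hpos.trans_le hx) (hpos.trans_le hy))
    calc g 0 * Real.exp (-1) = (g 0 * Real.exp (-1)) ^ (1 - t) * (g 0 * Real.exp (-1)) ^ t := by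
          rw [← Real.rpow_add hpos]; simp
      _ ≤ _ := by
          have := Real.rpow_nonneg (hpos.trans_le hx).le (1 - t)
          gcongr
  obtain ⟨R, hR⟩ := hconv.exists_norm_le_of_volume_ne_top hρ hball
    (hg.integrable.measure_ge_lt_top hpos).ne
  set R' := max R 1 + 1 with hR'
  have hR'1 : 0 < R' := by have := le_max_right R 1; linarith
  refine ⟨1 / R', by positivity, fun z => ?_⟩
  have hgz : g z / g 0 ≤ 1 := by rw [div_le_one h0]; exact hg.le_origin z
  rw [← Real.exp_add]
  rcases le_or_gt ‖z‖ R' with hz | hz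
  · refine hgz.trans (Real.one_le_exp ?_)
    have : ‖z‖ / R' ≤ 1 := by rwa [div_le_one hR'1]
    have e : -(1 / R') * ‖z‖ = -(‖z‖ / R') := by ring
    rw [e]
    linarith
  rcases (hg.nonneg z).eq_or_lt with hz0 | hz0
  · rw [← hz0, zero_div]; exact (Real.exp_pos _).le
  have hzn : 0 < ‖z‖ := hR'1.trans hz
  -- The point `l • z` has norm `R' > R`, hence lies outside the superlevel set.
  set l := R' / ‖z‖ with hl
  have hl0 : 0 < l := by positivity
  have hl1 : l < 1 := by rwa [hl, div_lt_one hzn]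
  have h1 := hg.logConcave' hl0 hl1 h0 hz0
  rw [smul_zero, zero_add] at h1
  have h2 : g (l • z) < g 0 * Real.exp (-1) := by
    by_contra! h
    have := hR _ h
    rw [norm_smul, Real.norm_of_nonneg hl0.le, hl, div_mul_cancel₀ _ hzn.ne'] at this
    have := le_max_left R 1
    linarith
  have h3 := Real.log_le_log (by positivity) (h1.trans h2.le)
  rw [Real.log_mul (by positivity) (by positivity), Real.log_mul (by positivity) (by positivity),
    Real.log_rpow h0, Real.log_rpow hz0, Real.log_exp] at h3
  have h4 : l * (Real.log (g z) - Real.log (g 0)) ≤ -1 := by linarith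
  have h5 : Real.log (g z / g 0) ≤ -(1 / R') * ‖z‖ := by
    rw [Real.log_div hz0.ne' h0.ne']
    have e : -(1 / R') * ‖z‖ = -1 / l := by rw [hl]; field_simp
    rw [e, le_div_iff₀ hl0]
    linarith
  calc g z / g 0 = Real.exp (Real.log (g z / g 0)) := (Real.exp_log (by positivity)).symm
    _ ≤ _ := Real.exp_le_exp.2 (by linarith)

theorem exists_hasRadialControl (hg : IsLC0 g) :
    ∃ A c, 0 < c ∧ HasRadialControl A c fun z => g z / g 0 := by
  obtain ⟨ρ, hρ, A, hA⟩ := hg.exists_one_sub_le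
  obtain ⟨c, hc, hle⟩ := hg.exists_le_exp
  have h0 := hg.origin_pos
  refine ⟨max (max A (1 / ρ)) (Real.exp 1), c, hc, fun z => div_nonneg (hg.nonneg z) h0.le,
    fun z => by rw [div_le_one h0]; exact hg.le_origin z, fun z => ?_, fun z => ?_⟩
  · refine le_trans ?_ (mul_le_mul_of_nonneg_right (le_max_left _ _) (norm_nonneg z))
    · show 1 - g z / g 0 ≤ max A (1 / ρ) * ‖z‖
      rcases lt_or_ge ‖z‖ ρ with h | h
      · exact (hA z (by simpa using h)).2.trans (by gcongr; exact le_max_left _ _)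
      · have h2 : 0 ≤ g z / g 0 := div_nonneg (hg.nonneg z) h0.le
        have h3 : 1 ≤ 1 / ρ * ‖z‖ := by
          rw [div_mul_eq_mul_div, one_mul, one_le_div hρ]; exact h
        have h4 : 1 / ρ * ‖z‖ ≤ max A (1 / ρ) * ‖z‖ := by gcongr; exact le_max_right _ _
        linarith
  · exact (hle z).trans (by gcongr; exact le_max_right _ _)

theorem logConcave_normalized (hg : IsLC0 g) : LogConcave fun z => g z / g 0 := by
  intro l hl0 hl1 x y hx hy
  have h0 := hg.origin_pos
  have hx' : 0 < g x := by simpa [h0] using hx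
  have hy' : 0 < g y := by simpa [h0] using hy
  rw [Real.div_rpow hx'.le h0.le, Real.div_rpow hy'.le h0.le, div_mul_div_comm,
    ← Real.rpow_add h0, sub_add_cancel, Real.rpow_one]
  exact div_le_div_of_nonneg_right (hg.logConcave' hl0 hl1 hx' hy') h0.le

theorem upperSemicontinuous_normalized (hg : IsLC0 g) :
    UpperSemicontinuous fun z => g z / g 0 := by
  intro z a ha
  have h0 := hg.origin_pos
  rw [div_lt_iff₀ h0] at ha
  filter_upwards [hg.upperSemicontinuous z _ ha] with w hw
  rwa [div_lt_iff₀ h0]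

theorem rayMoment_quasiconcave (hg : IsLC0 g) {p : ℝ} (hp : -1 < p) (hp0 : p ≠ 0)
    {x v : EuclideanSpace ℝ (Fin n)} (hind : ∀ a b : ℝ, a • x + b • v = 0 → a = 0 ∧ b = 0)
    {t : ℝ} (ht : t ∈ Icc (0 : ℝ) 1) :
    min (rayMoment p (fun z => g z / g 0) x) (rayMoment p (fun z => g z / g 0) (x + v)) ≤
      rayMoment p (fun z => g z / g 0) (x + t • v) := by
  obtain ⟨A, c, hc, h⟩ := hg.exists_hasRadialControl
  exact h.rayMoment_quasiconcave hp hp0 hg.logConcave_normalized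
    hg.upperSemicontinuous_normalized hc hind ht

end IsLC0

/-! ### From quasi-concave moments to gauges, for `p ≠ 0`. -/

theorem setIntegral_Ioi_pos {F : ℝ → ℝ} (hF : IntegrableOn F (Ioi 0))
    (h0 : ∀ r, 0 < r → 0 ≤ F r) {a b : ℝ} (ha : 0 ≤ a) (hab : a < b)
    (hpos : ∀ r, a < r → r < b → 0 < F r) : 0 < ∫ r in Ioi (0 : ℝ), F r := by
  rw [setIntegral_pos_iff_support_of_nonneg_ae
    ((ae_restrict_iff' measurableSet_Ioi).2 (ae_of_all _ h0)) hF]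
  have hsub : Ioo a b ⊆ Function.support F ∩ Ioi 0 := fun r hr =>
    ⟨(hpos r hr.1 hr.2).ne', ha.trans_lt hr.1⟩
  refine lt_of_lt_of_le ?_ (measure_mono hsub)
  simp [hab]

theorem rayMoment_smul {E : Type*} [NormedAddCommGroup E] [InnerProductSpace ℝ E] (p : ℝ)
    (f : E → ℝ) (x : E) {t : ℝ} (ht : 0 < t) :
    rayMoment p f (t • x) = t ^ (-p) * rayMoment p f x := by
  have h := integral_comp_mul_left_Ioi
    (fun r : ℝ => r ^ (p - 1) * (f (r • x) - if p < 0 then 1 else 0)) 0 ht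
  rw [mul_zero, smul_eq_mul] at h
  have h2 : ∫ r in Ioi (0 : ℝ), (t * r) ^ (p - 1) * (f ((t * r) • x) - if p < 0 then 1 else 0) =
      t ^ (p - 1) * rayMoment p f (t • x) := by
    rw [rayMoment, ← integral_const_mul]
    refine setIntegral_congr_fun measurableSet_Ioi fun r hr => ?_
    have hr : 0 < r := hr
    rw [Real.mul_rpow ht.le hr.le, smul_smul, mul_comm r t]
    ring
  rw [h2] at h
  change _ = t⁻¹ * rayMoment p f x at h
  have h3 : t ^ (-p) * t ^ (p - 1) = t⁻¹ := by
    rw [← Real.rpow_add ht, ← Real.rpow_neg_one]; congr 1; ring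
  have h4 : t ^ p * t ^ (-p) = 1 := by rw [← Real.rpow_add ht]; simp
  have h5 : t ^ (p - 1) = t ^ p * t⁻¹ := by rw [Real.rpow_sub_one ht.ne', div_eq_mul_inv]
  have h6 : t ^ p ≠ 0 := (Real.rpow_pos_of_pos ht _).ne'
  rw [h5, mul_assoc, mul_left_comm] at h
  have h7 := mul_left_cancel₀ (inv_ne_zero ht.ne') h
  rw [← h7, ← mul_assoc, mul_comm (t ^ (-p)), h4, one_mul]

/-- A positive, positively homogeneous function which is quasi-convex on segments of lines missing
the origin is a gauge. -/
theorem isGauge_of_quasiconvex {n : ℕ} {N : EuclideanSpace ℝ (Fin n) → ℝ} (h0 : N 0 = 0)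
    (hpos : ∀ x, x ≠ 0 → 0 < N x) (hhom : ∀ t : ℝ, 0 < t → ∀ x, N (t • x) = t * N x)
    (hquasi : ∀ x v : EuclideanSpace ℝ (Fin n), (∀ a b : ℝ, a • x + b • v = 0 → a = 0 ∧ b = 0) →
      ∀ t ∈ Icc (0 : ℝ) 1, N (x + t • v) ≤ max (N x) (N (x + v))) : IsGauge N := by
  have hnn : ∀ x, 0 ≤ N x := fun x => by
    by_cases hx : x = 0
    · rw [hx, h0]
    · exact (hpos x hx).le
  have hadd : ∀ x y, N (x + y) ≤ N x + N y := by
    intro x y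
    by_cases hx : x = 0
    · simp [hx, h0]
    by_cases hy : y = 0
    · simp [hy, h0]
    have hNx := hpos x hx
    have hNy := hpos y hy
    by_cases hind : ∀ a b : ℝ, a • x + b • y = 0 → a = 0 ∧ b = 0
    -- Both vectors are scaled to `N = 1`; the weight `N y / (N x + N y)` makes the convex
    -- combination a multiple of `x + y`.
    · set u := (N x)⁻¹ • x with hu
      set w := (N y)⁻¹ • y with hw
      have hNu : N u = 1 := by rw [hu, hhom _ (by positivity), inv_mul_cancel₀ hNx.ne']
      have hNw : N w = 1 := by rw [hw, hhom _ (by positivity), inv_mul_cancel₀ hNy.ne']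
      have h1 := hquasi u (w - u) (fun a b hab => by
        obtain ⟨e1, e2⟩ := hind ((a - b) * (N x)⁻¹) (b * (N y)⁻¹) (by
          rw [← hab, hu, hw]; module)
        have e3 : b = 0 := by simpa [hNy.ne'] using e2
        have e4 : a - b = 0 := by simpa [hNx.ne'] using e1
        exact ⟨by linarith, e3⟩) (N y / (N x + N y)) ⟨by positivity, by
          rw [div_le_one (by positivity)]; linarith⟩
      rw [add_sub_cancel, hNu, hNw, max_self] at h1
      have e : u + (N y / (N x + N y)) • (w - u) = (N x + N y)⁻¹ • (x + y) := by
        have e1 : u + (N y / (N x + N y)) • (w - u) =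
          (N x / (N x + N y)) • u + (N y / (N x + N y)) • w := by
          have : N x / (N x + N y) = 1 - N y / (N x + N y) := by field_simp; ring
          rw [this]; module
        rw [e1, hu, hw, smul_smul, smul_smul, smul_add]
        congr 2 <;> field_simp
      rw [e, hhom _ (by positivity), inv_mul_le_iff₀ (by positivity)] at h1
      linarith
    -- Dependent vectors are treated directly. Since `N` need not be even, the signs of `c` and `1 +
    -- c` both matter.
    · push Not at hind
      obtain ⟨a, b, hab, hne⟩ := hind
      have hb : b ≠ 0 := by
        rintro rfl
        rw [zero_smul, add_zero, smul_eq_zero] at hab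
        rcases hab with h | h
        · exact hne h rfl
        · exact hx h
      obtain ⟨c, rfl⟩ : ∃ c : ℝ, y = c • x := ⟨-(a / b), by
        have : b • y = b • (-(a / b)) • x := by
          rw [smul_smul, show b * -(a / b) = -a by field_simp, neg_smul]
          exact eq_neg_of_add_eq_zero_right hab
        exact smul_right_injective _ hb this⟩
      have e : x + c • x = (1 + c) • x := by module
      rcases lt_trichotomy (1 + c) 0 with h | h | h
      · have hc : c < 0 := by linarith
        have e2 : (1 + c) • x = ((1 + c) / c) • c • x := by
          rw [smul_smul, div_mul_cancel₀ _ hc.ne]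
        rw [e, e2, hhom _ (div_pos_of_neg_of_neg h hc)]
        have : (1 + c) / c ≤ 1 := by rw [div_le_one_of_neg hc]; linarith
        nlinarith
      · rw [e, h, zero_smul, h0]; positivity
      · rw [e, hhom _ h]
        rcases le_or_gt c 0 with hc | hc
        · nlinarith
        · rw [hhom _ hc]; linarith
  have hhom' : ∀ t : ℝ, 0 ≤ t → ∀ x, N (t • x) = t * N x := fun t ht x => by
    rcases ht.eq_or_lt with rfl | ht
    · simp [h0]
    · exact hhom t ht x
  refine ⟨hnn, hhom', convex_univ, fun x _ y _ s t hs ht _ => ?_⟩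
  refine (hadd _ _).trans_eq ?_
  rw [hhom' s hs, hhom' t ht, smul_eq_mul, smul_eq_mul]

namespace IsLC0

variable {n : ℕ} {g : EuclideanSpace ℝ (Fin n) → ℝ}

theorem measurable (hg : IsLC0 g) : Measurable g := hg.upperSemicontinuous.measurable

theorem measurable_ray (hg : IsLC0 g) (x : EuclideanSpace ℝ (Fin n)) :
    Measurable fun r : ℝ => g (r • x) := hg.measurable.comp (by fun_prop)

theorem integrableOn_rayMoment (hg : IsLC0 g) {p : ℝ} (hp : -1 < p) (hp0 : p ≠ 0)
    {x : EuclideanSpace ℝ (Fin n)} (hx : x ≠ 0) :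
    IntegrableOn (fun r : ℝ => r ^ (p - 1) * (g (r • x) / g 0 - if p < 0 then 1 else 0)) (Ioi 0) := by
  obtain ⟨A, c, hc, h⟩ := hg.exists_hasRadialControl
  exact h.integrableOn_ray hp hp0 hc hx ((hg.measurable_ray x).div_const _).aestronglyMeasurable

theorem mul_rayMoment_pos (hg : IsLC0 g) {p : ℝ} (hp : -1 < p) (hp0 : p ≠ 0)
    {x : EuclideanSpace ℝ (Fin n)} (hx : x ≠ 0) : 0 < p * rayMoment p (fun z => g z / g 0) x := by
  have h0 := hg.origin_pos
  have hint := hg.integrableOn_rayMoment hp hp0 hx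
  have hxn : 0 < ‖x‖ := norm_pos_iff.2 hx
  rcases hp0.lt_or_gt with h | h
  · refine mul_pos_of_neg_of_neg h ?_
    rw [rayMoment, ← neg_pos, ← integral_neg]
    obtain ⟨c, hc, hle⟩ := hg.exists_le_exp
    have hnn : ∀ r : ℝ, 0 < r → 0 < r ^ (p - 1) := fun r hr => Real.rpow_pos_of_pos hr _
    -- Beyond this radius `e * exp (-c * ‖r • x‖) < 1`, so the integrand is strictly negative.
    have ha : 0 < 2 / (c * ‖x‖) := by positivity
    refine setIntegral_Ioi_pos hint.neg (fun r hr => ?_) ha.le (lt_add_one _) fun r hr _ => ?_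
    · have h1 : g (r • x) / g 0 ≤ 1 := by rw [div_le_one h0]; exact hg.le_origin _
      simp only [h, if_true]
      rw [← mul_neg]
      exact mul_nonneg (hnn r hr).le (by linarith)
    · have h1 : g (r • x) / g 0 < 1 := by
        refine (hle _).trans_lt ?_
        rw [← Real.exp_add, Real.exp_lt_one_iff, norm_smul, Real.norm_of_nonneg (ha.trans hr).le]
        rw [div_lt_iff₀ (by positivity)] at hr
        linarith
      simp only [h, if_true]
      rw [← mul_neg]
      exact mul_pos (hnn r (ha.trans hr)) (by linarith)
  · refine mul_pos h ?_
    obtain ⟨ρ, hρ, A, hA⟩ := hg.exists_one_sub_le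
    refine setIntegral_Ioi_pos hint (fun r hr => ?_) le_rfl (div_pos hρ hxn) fun r hr hr2 => ?_
    · simp only [h.not_gt, if_false, sub_zero]
      exact mul_nonneg (Real.rpow_nonneg hr.le _) (div_nonneg (hg.nonneg _) h0.le)
    · simp only [h.not_gt, if_false, sub_zero]
      refine mul_pos (Real.rpow_pos_of_pos hr _) (div_pos (hA _ ?_).1 h0)
      rw [mem_ball_zero_iff, norm_smul, Real.norm_of_nonneg hr.le]
      rwa [lt_div_iff₀ hxn] at hr2

theorem ballFunctional_eq (hg : IsLC0 g) {p : ℝ} (hp0 : p ≠ 0)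
    {x : EuclideanSpace ℝ (Fin n)} (hx : x ≠ 0) :
    ballFunctional p g x = (p * rayMoment p (fun z => g z / g 0) x) ^ (-1 / p) := by
  have h0 := hg.origin_pos.ne'
  rw [ballFunctional, if_neg hx]
  rcases hp0.lt_or_gt with h | h
  · rw [if_neg h.not_gt, if_neg hp0, rayMoment, div_eq_mul_inv, mul_assoc, ← integral_const_mul]
    simp only [h, if_true]
    congr 2
    refine integral_congr_ae (ae_of_all _ fun r => ?_)
    simp only
    field_simp
  · rw [if_pos h, rayMoment, div_eq_mul_inv, mul_assoc, ← integral_const_mul]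
    simp only [h.not_gt, if_false]
    congr 2
    refine integral_congr_ae (ae_of_all _ fun r => ?_)
    simp only
    ring

theorem ballFunctional_pos_of_ne (hg : IsLC0 g) {p : ℝ} (hp : -1 < p) (hp0 : p ≠ 0)
    {x : EuclideanSpace ℝ (Fin n)} (hx : x ≠ 0) : 0 < ballFunctional p g x := by
  rw [hg.ballFunctional_eq hp0 hx]
  exact Real.rpow_pos_of_pos (hg.mul_rayMoment_pos hp hp0 hx) _

theorem isGauge_ballFunctional_of_ne (hg : IsLC0 g) {p : ℝ} (hp : -1 < p) (hp0 : p ≠ 0) :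
    IsGauge (ballFunctional p g) := by
  have hz : ballFunctional p g 0 = 0 := by simp [ballFunctional]
  refine isGauge_of_quasiconvex hz (fun x hx => hg.ballFunctional_pos_of_ne hp hp0 hx) ?_ ?_
  · intro t ht x
    by_cases hx : x = 0
    · simp [hx, hz]
    have hM := hg.mul_rayMoment_pos hp hp0 hx
    rw [hg.ballFunctional_eq hp0 hx, hg.ballFunctional_eq hp0 (smul_ne_zero ht.ne' hx),
      rayMoment_smul _ _ _ ht, mul_left_comm, Real.mul_rpow (by positivity) hM.le,
      ← Real.rpow_mul ht.le, show -p * (-1 / p) = 1 by field_simp, Real.rpow_one]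
  · intro x v hind t ht
    have hne : ∀ y : ℝ, x + y • v ≠ 0 := fun y h => by
      have := (hind 1 y (by rw [one_smul]; exact h)).1
      exact one_ne_zero this
    have h0 : x ≠ 0 := by simpa using hne 0
    have h1 : x + v ≠ 0 := by simpa using hne 1
    have key := hg.rayMoment_quasiconcave hp hp0 hind ht
    have p0 := hg.mul_rayMoment_pos hp hp0 h0
    have p1 := hg.mul_rayMoment_pos hp hp0 h1
    have pt := hg.mul_rayMoment_pos hp hp0 (hne t)
    rw [hg.ballFunctional_eq hp0 h0, hg.ballFunctional_eq hp0 h1, hg.ballFunctional_eq hp0 (hne t)]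
    -- For `p < 0`, multiplication by `p` reverses the inequality and the power is increasing; for
    -- `p > 0` only the power reverses it.
    rcases hp0.lt_or_gt with h | h
    · have he : 0 ≤ -1 / p := div_nonneg_of_nonpos (by norm_num) h.le
      rcases min_le_iff.1 key with k | k
      · exact (Real.rpow_le_rpow pt.le (mul_le_mul_of_nonpos_left k h.le) he).trans (le_max_left _ _)
      · exact (Real.rpow_le_rpow pt.le (mul_le_mul_of_nonpos_left k h.le) he).trans (le_max_right _ _)
    · have he : -1 / p ≤ 0 := div_nonpos_of_nonpos_of_nonneg (by norm_num) h.le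
      rcases min_le_iff.1 key with k | k
      · exact (Real.rpow_le_rpow_of_nonpos p0 (mul_le_mul_of_nonneg_left k h.le) he).trans
          (le_max_left _ _)
      · exact (Real.rpow_le_rpow_of_nonpos p1 (mul_le_mul_of_nonneg_left k h.le) he).trans
          (le_max_right _ _)

end IsLC0

/-! ### The case `p = 0`: moments of the decay measure and the limit of `p` to `0`. -/

namespace IsLC0

variable {n : ℕ} {g : EuclideanSpace ℝ (Fin n) → ℝ}

theorem rayDecay_eq (hg : IsLC0 g) (x : EuclideanSpace ℝ (Fin n)) :
    rayDecay g x = (hg.monotone_neg_ray x).stieltjesFunction.measure := dif_pos _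

/-- The Stieltjes function is minus the right limit of `g` along the ray, so values of `g` bound it
only from strictly larger parameters. -/
theorem le_neg_stieltjesFunction (hg : IsLC0 g) (x : EuclideanSpace ℝ (Fin n)) {s t : ℝ}
    (ht : 0 ≤ t) (hts : t < s) : g (s • x) ≤ -(hg.monotone_neg_ray x).stieltjesFunction t := by
  have h := (hg.monotone_neg_ray x).rightLim_le hts
  simp only [max_eq_left (ht.trans hts.le)] at h
  exact le_neg_of_le_neg h

theorem neg_stieltjesFunction_le (hg : IsLC0 g) (x : EuclideanSpace ℝ (Fin n)) {t : ℝ}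
    (ht : 0 ≤ t) : -(hg.monotone_neg_ray x).stieltjesFunction t ≤ g (t • x) := by
  have h := (hg.monotone_neg_ray x).le_rightLim (le_refl t)
  simp only [max_eq_left ht] at h
  exact neg_le_of_neg_le h

theorem neg_stieltjesFunction_nonneg (hg : IsLC0 g) (x : EuclideanSpace ℝ (Fin n)) {t : ℝ}
    (ht : 0 ≤ t) : 0 ≤ -(hg.monotone_neg_ray x).stieltjesFunction t :=
  (hg.nonneg _).trans (hg.le_neg_stieltjesFunction x ht (lt_add_one t))

theorem tendsto_ray_atTop (hg : IsLC0 g) {x : EuclideanSpace ℝ (Fin n)} (hx : x ≠ 0) :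
    Tendsto (fun t : ℝ => g (t • x)) atTop (𝓝 0) := by
  obtain ⟨c, hc, hle⟩ := hg.exists_le_exp
  have h0 := hg.origin_pos
  have hxn : 0 < ‖x‖ := norm_pos_iff.2 hx
  have hlim : Tendsto (fun t : ℝ => g 0 * (Real.exp 1 * Real.exp (-((c * ‖x‖) * t)))) atTop
      (𝓝 (g 0 * (Real.exp 1 * 0))) := by
    refine ((Real.tendsto_exp_neg_atTop_nhds_zero.comp
      (tendsto_id.const_mul_atTop (by positivity : 0 < c * ‖x‖))).const_mul _).const_mul _
  rw [mul_zero, mul_zero] at hlim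
  refine tendsto_of_tendsto_of_tendsto_of_le_of_le' tendsto_const_nhds hlim
    (Eventually.of_forall fun t => hg.nonneg _) ?_
  filter_upwards [eventually_ge_atTop 0] with t ht
  have := hle (t • x)
  rw [div_le_iff₀ h0, norm_smul, Real.norm_of_nonneg ht] at this
  refine this.trans_eq ?_
  rw [mul_comm]
  congr 3
  ring

theorem tendsto_stieltjesFunction_atTop (hg : IsLC0 g) {x : EuclideanSpace ℝ (Fin n)}
    (hx : x ≠ 0) : Tendsto (hg.monotone_neg_ray x).stieltjesFunction atTop (𝓝 0) := by
  have h := (hg.tendsto_ray_atTop hx).neg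
  rw [neg_zero] at h
  refine tendsto_of_tendsto_of_tendsto_of_le_of_le' h tendsto_const_nhds ?_ ?_
  · filter_upwards [eventually_ge_atTop 0] with t ht
    exact neg_le.1 (hg.neg_stieltjesFunction_le x ht)
  · filter_upwards [eventually_ge_atTop 0] with t ht
    exact neg_nonneg.1 (hg.neg_stieltjesFunction_nonneg x ht)

theorem rayDecay_Ioi (hg : IsLC0 g) {x : EuclideanSpace ℝ (Fin n)} (hx : x ≠ 0) (t : ℝ) :
    rayDecay g x (Ioi t) = ENNReal.ofReal (-(hg.monotone_neg_ray x).stieltjesFunction t) := by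
  rw [hg.rayDecay_eq, StieltjesFunction.measure_Ioi _ (hg.tendsto_stieltjesFunction_atTop hx),
    zero_sub]

/-- The linear bound at the origin rules out a jump at `0`; hence the decay measure of `(0, ∞)` is
all of `g 0`. -/
theorem stieltjesFunction_zero (hg : IsLC0 g) (x : EuclideanSpace ℝ (Fin n)) :
    (hg.monotone_neg_ray x).stieltjesFunction 0 = -g 0 := by
  obtain ⟨A, c, hc, hctl⟩ := hg.exists_hasRadialControl
  have h0 := hg.origin_pos
  refine le_antisymm ?_ (neg_le.1 (by simpa using hg.neg_stieltjesFunction_le x le_rfl))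
  have hlim : Tendsto (fun s : ℝ => g 0 * (1 - A * (s * ‖x‖))) (𝓝[>] 0) (𝓝 (g 0)) := by
    have : ContinuousAt (fun s : ℝ => g 0 * (1 - A * (s * ‖x‖))) 0 := by fun_prop
    simpa [ContinuousAt] using this.tendsto.mono_left nhdsWithin_le_nhds
  rw [le_neg]
  refine le_of_tendsto hlim ?_
  filter_upwards [self_mem_nhdsWithin] with s hs
  have hs : 0 < s := hs
  refine le_trans ?_ (hg.le_neg_stieltjesFunction x le_rfl hs)
  have h := hctl.one_sub_le (s • x)
  rw [norm_smul, Real.norm_of_nonneg hs.le, sub_le_comm, le_div_iff₀ h0] at h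
  linarith

theorem stieltjesFunction_eq_ae (hg : IsLC0 g) (x : EuclideanSpace ℝ (Fin n)) :
    ∀ᵐ t ∂(volume.restrict (Ioi (0 : ℝ))),
      -(hg.monotone_neg_ray x).stieltjesFunction t = g (t • x) := by
  rw [ae_restrict_iff' measurableSet_Ioi]
  filter_upwards [(hg.monotone_neg_ray x).countable_not_continuousAt.ae_notMem volume] with t ht h0
  have hc : ContinuousAt (fun r : ℝ => -g (max r 0 • x)) t := not_not.1 ht
  have : (hg.monotone_neg_ray x).stieltjesFunction t = -g (max t 0 • x) :=
    hc.continuousWithinAt.rightLim_eq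
  rw [this, neg_neg, max_eq_left (le_of_lt h0)]

theorem rayDecay_Ioi_zero (hg : IsLC0 g) {x : EuclideanSpace ℝ (Fin n)} (hx : x ≠ 0) :
    rayDecay g x (Ioi 0) = ENNReal.ofReal (g 0) := by
  rw [hg.rayDecay_Ioi hx, hg.stieltjesFunction_zero, neg_neg]

/-- Layer cake: the mass of `(t, ∞)` is `g (t • x)` for almost every `t`. -/
theorem lintegral_rpow_rayDecay (hg : IsLC0 g) {x : EuclideanSpace ℝ (Fin n)} (hx : x ≠ 0)
    {p : ℝ} (hp : 0 < p) :
    ∫⁻ r in Ioi 0, ENNReal.ofReal (r ^ p) ∂(rayDecay g x) =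
      ENNReal.ofReal (g 0 * (p * rayMoment p (fun z => g z / g 0) x)) := by
  have h0 := hg.origin_pos
  have hint := hg.integrableOn_rayMoment (by linarith) hp.ne' hx
  simp only [hp.not_gt, if_false, sub_zero] at hint
  rw [lintegral_rpow_eq_lintegral_meas_lt_mul ((rayDecay g x).restrict (Ioi 0))
    ((ae_restrict_iff' measurableSet_Ioi).2 (ae_of_all _ fun r (hr : 0 < r) => hr.le))
    aemeasurable_id hp]
  have e : ∫⁻ t in Ioi (0 : ℝ), (rayDecay g x).restrict (Ioi 0) {a | t < a} *
      ENNReal.ofReal (t ^ (p - 1)) =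
      ∫⁻ t in Ioi (0 : ℝ), ENNReal.ofReal (g 0 * (t ^ (p - 1) * (g (t • x) / g 0))) := by
    refine lintegral_congr_ae ?_
    filter_upwards [hg.stieltjesFunction_eq_ae x, self_mem_ae_restrict measurableSet_Ioi]
      with t ht ht0
    have ht0 : 0 < t := ht0
    have : {a : ℝ | t < a} = Ioi t := rfl
    rw [this, Measure.restrict_apply measurableSet_Ioi, Ioi_inter_Ioi, max_eq_left ht0.le,
      hg.rayDecay_Ioi hx, ht, ← ENNReal.ofReal_mul (hg.nonneg _)]
    congr 1
    field_simp
  rw [e, ← ofReal_integral_eq_lintegral_ofReal (hint.const_mul _), integral_const_mul,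
    ← ENNReal.ofReal_mul hp.le, rayMoment]
  · simp only [hp.not_gt, if_false, sub_zero]
    congr 1
    ring
  · filter_upwards [self_mem_ae_restrict measurableSet_Ioi] with t ht
    exact mul_nonneg h0.le (mul_nonneg (Real.rpow_nonneg (le_of_lt ht) _)
      (div_nonneg (hg.nonneg _) h0.le))

theorem integrableOn_rpow_rayDecay (hg : IsLC0 g) {x : EuclideanSpace ℝ (Fin n)} (hx : x ≠ 0)
    {p : ℝ} (hp : 0 < p) : IntegrableOn (fun r : ℝ => r ^ p) (Ioi 0) (rayDecay g x) := by
  refine ⟨(by fun_prop : Measurable fun r : ℝ => r ^ p).aestronglyMeasurable, ?_⟩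
  rw [hasFiniteIntegral_iff_ofReal, hg.lintegral_rpow_rayDecay hx hp]
  · exact ENNReal.ofReal_lt_top
  · filter_upwards [self_mem_ae_restrict measurableSet_Ioi] with t ht
    exact Real.rpow_nonneg (le_of_lt ht) _

theorem setIntegral_rpow_rayDecay (hg : IsLC0 g) {x : EuclideanSpace ℝ (Fin n)} (hx : x ≠ 0)
    {p : ℝ} (hp : 0 < p) : ∫ r in Ioi 0, r ^ p ∂(rayDecay g x) =
      g 0 * (p * rayMoment p (fun z => g z / g 0) x) := by
  rw [integral_eq_lintegral_of_nonneg_ae, hg.lintegral_rpow_rayDecay hx hp, ENNReal.toReal_ofReal]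
  · exact (mul_pos hg.origin_pos (hg.mul_rayMoment_pos (by linarith) hp.ne' hx)).le
  · filter_upwards [self_mem_ae_restrict measurableSet_Ioi] with t ht
    exact Real.rpow_nonneg (le_of_lt ht) _
  · exact (by fun_prop : Measurable fun r : ℝ => r ^ p).aestronglyMeasurable

/-- Layer cake in `1 / r`: the mass of `(0, 1/t]` is at most `min (g 0) (B / t)`. Some negative
moment is needed to place `0` in the interior of the exponents of integrability. -/
theorem integrableOn_rpow_neg_half_rayDecay (hg : IsLC0 g) {x : EuclideanSpace ℝ (Fin n)}
    (hx : x ≠ 0) :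
    IntegrableOn (fun r : ℝ => r⁻¹ ^ (1 / 2 : ℝ)) (Ioi 0) (rayDecay g x) := by
  obtain ⟨A, c, hc, hctl⟩ := hg.exists_hasRadialControl
  have h0 := hg.origin_pos
  have hnn : 0 ≤ᵐ[(rayDecay g x).restrict (Ioi 0)] fun r : ℝ => r⁻¹ := by
    filter_upwards [self_mem_ae_restrict measurableSet_Ioi] with t ht
    exact inv_nonneg.2 (le_of_lt ht)
  refine ⟨(by fun_prop : Measurable fun r : ℝ => r⁻¹ ^ (1 / 2 : ℝ)).aestronglyMeasurable, ?_⟩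
  rw [hasFiniteIntegral_iff_ofReal (hnn.mono fun t ht => Real.rpow_nonneg ht _),
    lintegral_rpow_eq_lintegral_meas_lt_mul _ hnn measurable_inv.aemeasurable (by norm_num)]
  refine ENNReal.mul_lt_top ENNReal.ofReal_lt_top ?_
  have hA1 : 0 < max A 1 * ‖x‖ := mul_pos (lt_max_of_lt_right one_pos) (norm_pos_iff.2 hx)
  -- The factor `2` comes from comparing the right limit at `t⁻¹` with `g` at the larger parameter
  -- `2 * t⁻¹`.
  set B : ℝ := 2 * g 0 * (max A 1 * ‖x‖) with hB
  have hB0 : 0 < B := by positivity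
  have hb := (integrableOn_rayBound (p := -(1 / 2)) (A := g 0 / B) (c := 1) (by norm_num)
    (by norm_num) (by positivity) one_pos).const_mul B
  refine lt_of_le_of_lt (setLIntegral_mono_ae' measurableSet_Ioi (ae_of_all _ fun t ht => ?_))
    hb.lintegral_lt_top
  have ht : 0 < t := ht
  have hset : {a : ℝ | t < a⁻¹} ∩ Ioi 0 ⊆ Ioc 0 t⁻¹ := fun a ha =>
    ⟨ha.2, (le_inv_comm₀ ht ha.2).1 (le_of_lt ha.1)⟩
  have hmeas : MeasurableSet {a : ℝ | t < a⁻¹} := measurableSet_lt measurable_const measurable_inv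
  have h1 : (rayDecay g x).restrict (Ioi 0) {a | t < a⁻¹} ≤ ENNReal.ofReal (min (g 0) (B / t)) := by
    rw [Measure.restrict_apply hmeas]
    refine (measure_mono hset).trans ?_
    rw [hg.rayDecay_eq, StieltjesFunction.measure_Ioc, hg.stieltjesFunction_zero]
    refine ENNReal.ofReal_le_ofReal (le_min ?_ ?_)
    · have := hg.neg_stieltjesFunction_nonneg x (inv_pos.2 ht).le
      linarith
    · have h2 := hg.le_neg_stieltjesFunction x (inv_pos.2 ht).le
        (show t⁻¹ < 2 * t⁻¹ by linarith [inv_pos.2 ht])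
      have h3 := hctl.one_sub_le ((2 * t⁻¹) • x)
      rw [norm_smul, Real.norm_of_nonneg (by positivity), sub_le_comm, le_div_iff₀ h0] at h3
      have h4 : A * (2 * t⁻¹ * ‖x‖) * g 0 ≤ B / t := by
        rw [hB, div_eq_mul_inv]
        have : A * (2 * t⁻¹ * ‖x‖ * g 0) ≤ max A 1 * (2 * t⁻¹ * ‖x‖ * g 0) :=
          mul_le_mul_of_nonneg_right (le_max_left _ _) (by positivity)
        linarith
      linarith
  refine (mul_le_mul_left h1 _).trans ?_
  rw [← ENNReal.ofReal_mul (by positivity)]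
  refine ENNReal.ofReal_le_ofReal (le_of_eq ?_)
  have hr : t ^ (-(1 / 2) - 1 : ℝ) = t ^ (1 / 2 - 1 : ℝ) * t⁻¹ := by
    rw [← div_eq_mul_inv, ← Real.rpow_sub_one ht.ne']
    norm_num
  rw [rayBound, if_pos (by norm_num), hr, mul_comm (min _ _), mul_left_comm B, mul_assoc]
  congr 1
  rw [mul_min_of_nonneg _ _ hB0.le, mul_min_of_nonneg _ _ (inv_pos.2 ht).le, min_comm]
  congr 1
  · field_simp
  · field_simp

theorem exp_mul_log_ae (x : EuclideanSpace ℝ (Fin n)) (p : ℝ) :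
    (fun r : ℝ => Real.exp (p * Real.log r)) =ᵐ[(rayDecay g x).restrict (Ioi 0)]
      fun r => r ^ p := by
  filter_upwards [self_mem_ae_restrict measurableSet_Ioi] with r hr
  rw [Real.rpow_def_of_pos hr, mul_comm]

/-- Finite moments of orders `1` and `-1/2` bracket `0`, so `log` is integrable and its moment
generating function is differentiable at `0`. -/
theorem zero_mem_interior_integrableExpSet_log (hg : IsLC0 g) {x : EuclideanSpace ℝ (Fin n)}
    (hx : x ≠ 0) : (0 : ℝ) ∈ interior
      (ProbabilityTheory.integrableExpSet Real.log ((rayDecay g x).restrict (Ioi 0))) := by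
  have h1 : (1 : ℝ) ∈ ProbabilityTheory.integrableExpSet Real.log
      ((rayDecay g x).restrict (Ioi 0)) :=
    (integrable_congr (exp_mul_log_ae x 1)).2 (hg.integrableOn_rpow_rayDecay hx one_pos)
  have h2 : (-(1 / 2) : ℝ) ∈ ProbabilityTheory.integrableExpSet Real.log
      ((rayDecay g x).restrict (Ioi 0)) := by
    refine (integrable_congr (exp_mul_log_ae x _)).2
      ((integrable_congr ?_).1 (hg.integrableOn_rpow_neg_half_rayDecay hx))
    filter_upwards [self_mem_ae_restrict measurableSet_Ioi] with r hr
    rw [Real.rpow_neg (le_of_lt hr), Real.inv_rpow (le_of_lt hr)]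
  have hsub := ProbabilityTheory.convex_integrableExpSet.ordConnected.out h2 h1
  exact interior_mono hsub (by rw [interior_Icc]; constructor <;> norm_num)

theorem integrableOn_log_rayDecay (hg : IsLC0 g) {x : EuclideanSpace ℝ (Fin n)} (hx : x ≠ 0) :
    IntegrableOn Real.log (Ioi 0) (rayDecay g x) :=
  ProbabilityTheory.integrable_of_mem_interior_integrableExpSet
    (hg.zero_mem_interior_integrableExpSet_log hx)

/-- With `Λ` the moment generating function of `log r`, the functional at `p > 0` is `exp` of minus
the slope of `log (Λ / g 0)` between `0` and `p`. The limiting slope is `Λ'(0) / g 0`, where `Λ'(0)`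
is the integral of `log r`. -/
theorem tendsto_ballFunctional_zero (hg : IsLC0 g) (x : EuclideanSpace ℝ (Fin n)) :
    Tendsto (fun p => ballFunctional p g x) (𝓝[>] 0) (𝓝 (ballFunctional 0 g x)) := by
  by_cases hx : x = 0
  · simp [ballFunctional, hx]
  have h0 := hg.origin_pos
  set ν := (rayDecay g x).restrict (Ioi 0) with hν
  have hd := ProbabilityTheory.hasDerivAt_mgf (hg.zero_mem_interior_integrableExpSet_log hx)
  simp only [zero_mul, Real.exp_zero, mul_one] at hd
  have hM0 : ProbabilityTheory.mgf Real.log ν 0 = g 0 := by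
    simp [ProbabilityTheory.mgf, hν, hg.rayDecay_Ioi_zero hx, Measure.real, h0.le]
  have hlog := (hd.div_const (g 0)).log (by rw [hM0, div_self h0.ne']; exact one_ne_zero)
  rw [hM0, div_self h0.ne', div_one] at hlog
  have hs := (hasDerivAt_iff_tendsto_slope.1 hlog).mono_left
    (nhdsWithin_mono _ fun y (hy : 0 < y) => hy.ne')
  have he := (Real.continuous_exp.tendsto _).comp hs.neg
  have hz : ballFunctional 0 g x = Real.exp (-((∫ r, Real.log r ∂ν) / g 0)) := by
    rw [ballFunctional, if_neg hx, if_neg (lt_irrefl _), if_pos rfl]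
    congr 1
    ring
  rw [hz]
  refine he.congr' ?_
  filter_upwards [self_mem_nhdsWithin] with p hp
  have hp : 0 < p := hp
  have hmp : ProbabilityTheory.mgf Real.log ν p =
      g 0 * (p * rayMoment p (fun z => g z / g 0) x) := by
    rw [← hg.setIntegral_rpow_rayDecay hx hp]
    exact integral_congr_ae (exp_mul_log_ae x p)
  have hpos := hg.mul_rayMoment_pos (by linarith) hp.ne' hx
  rw [hg.ballFunctional_eq hp.ne' hx, Real.rpow_def_of_pos hpos]
  simp only [Function.comp, slope_def_field]
  rw [hmp, hM0, div_self h0.ne', Real.log_one, mul_div_cancel_left₀ _ h0.ne']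
  congr 1
  generalize p * rayMoment p (fun z => g z / g 0) x = R
  ring

theorem ballFunctional_pos (hg : IsLC0 g) {p : ℝ} (hp : -1 < p)
    {x : EuclideanSpace ℝ (Fin n)} (hx : x ≠ 0) : 0 < ballFunctional p g x := by
  by_cases hp0 : p = 0
  · rw [ballFunctional, if_neg hx, hp0, if_neg (lt_irrefl _), if_pos rfl]
    exact Real.exp_pos _
  · exact hg.ballFunctional_pos_of_ne hp hp0 hx

theorem isGauge_ballFunctional (hg : IsLC0 g) {p : ℝ} (hp : -1 < p) :
    IsGauge (ballFunctional p g) := by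
  by_cases hp0 : p = 0
  · subst hp0
    have hG : ∀ᶠ p in 𝓝[>] (0 : ℝ), IsGauge (ballFunctional p g) := by
      filter_upwards [self_mem_nhdsWithin] with p (hp : 0 < p)
      exact hg.isGauge_ballFunctional_of_ne (by linarith) hp.ne'
    have ht := hg.tendsto_ballFunctional_zero
    refine ⟨fun x => ge_of_tendsto (ht x) (hG.mono fun p h => h.1 x), fun t h0 x => ?_,
      convex_univ, fun x _ y _ a b ha hb hab => ?_⟩
    · exact tendsto_nhds_unique_of_eventuallyEq (ht _) ((ht x).const_mul t)
        (hG.mono fun p h => h.2.1 t h0 x)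
    · exact le_of_tendsto_of_tendsto (ht _) (((ht x).const_mul a).add ((ht y).const_mul b))
        (hG.mono fun p h => h.2.2.2 (mem_univ _) (mem_univ _) ha hb hab)
  · exact hg.isGauge_ballFunctional_of_ne hp hp0

end IsLC0

/-! ### Unit balls and Minkowski functionals of gauges. -/

namespace IsGauge

variable {n : ℕ} {N : EuclideanSpace ℝ (Fin n) → ℝ}

theorem continuous (hN : IsGauge N) : Continuous N := hN.2.2.locallyLipschitz.continuous

theorem map_zero (hN : IsGauge N) : N 0 = 0 := by
  simpa using hN.2.1 0 le_rfl 0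

theorem zero_mem_interior_sublevel (hN : IsGauge N) : 0 ∈ interior {x | N x ≤ 1} := by
  rw [mem_interior_iff_mem_nhds]
  have h : {x | N x < 1} ∈ 𝓝 (0 : EuclideanSpace ℝ (Fin n)) :=
    (isOpen_lt hN.continuous continuous_const).mem_nhds (by simp [hN.map_zero])
  exact mem_of_superset h fun x (hx : N x < 1) => hx.le

/-- A gauge which is positive off the origin dominates a multiple of the norm. -/
theorem exists_mul_norm_le (hN : IsGauge N) (hpos : ∀ x, x ≠ 0 → 0 < N x) :
    ∃ m > 0, ∀ x, m * ‖x‖ ≤ N x := by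
  -- The unit sphere is empty exactly when `n = 0`.
  rcases (Metric.sphere (0 : EuclideanSpace ℝ (Fin n)) 1).eq_empty_or_nonempty with he | hne
  · refine ⟨1, one_pos, fun x => ?_⟩
    by_cases hx : x = 0
    · simp [hx, hN.map_zero]
    · exfalso
      have : ‖x‖⁻¹ • x ∈ Metric.sphere (0 : EuclideanSpace ℝ (Fin n)) 1 := by
        simp [norm_smul, hx]
      rw [he] at this
      exact this
  · obtain ⟨z, hz, hmin⟩ := (isCompact_sphere (0 : EuclideanSpace ℝ (Fin n)) 1).exists_isMinOn hne
      hN.continuous.continuousOn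
    have hz1 : ‖z‖ = 1 := by simpa using hz
    refine ⟨N z, hpos z (by rintro rfl; simp at hz1), fun x => ?_⟩
    by_cases hx : x = 0
    · simp [hx, hN.map_zero]
    · have hxn : 0 < ‖x‖ := norm_pos_iff.2 hx
      have h := hmin (show ‖x‖⁻¹ • x ∈ Metric.sphere (0 : EuclideanSpace ℝ (Fin n)) 1 by
        simp [norm_smul, hx])
      have h : N z ≤ N (‖x‖⁻¹ • x) := h
      rw [hN.2.1 _ (inv_nonneg.2 hxn.le), le_inv_mul_iff₀ hxn] at h
      linarith

theorem isConvexBody_sublevel (hN : IsGauge N) (hpos : ∀ x, x ≠ 0 → 0 < N x) :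
    IsConvexBody {x | N x ≤ 1} := by
  obtain ⟨m, hm, hle⟩ := hN.exists_mul_norm_le hpos
  refine ⟨by simpa using hN.2.2.convex_le 1, ?_, ⟨0, hN.zero_mem_interior_sublevel⟩⟩
  refine (isCompact_closedBall (0 : EuclideanSpace ℝ (Fin n)) (1 / m)).of_isClosed_subset
    (isClosed_le hN.continuous continuous_const) fun x hx => ?_
  rw [mem_closedBall_zero_iff, le_div_iff₀ hm, mul_comm]
  exact (hle x).trans hx

theorem gauge_sublevel (hN : IsGauge N) (x : EuclideanSpace ℝ (Fin n)) :
    gauge {x | N x ≤ 1} x = N x := by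
  have hmem : ∀ r : ℝ, 0 < r → (x ∈ r • {x | N x ≤ 1} ↔ N x ≤ r) := fun r hr => by
    rw [mem_smul_set_iff_inv_smul_mem₀ hr.ne']
    change N (r⁻¹ • x) ≤ 1 ↔ _
    rw [hN.2.1 _ (inv_nonneg.2 hr.le), inv_mul_le_iff₀ hr, mul_one]
  refine le_antisymm (le_of_forall_gt_imp_ge_of_dense fun r hr => ?_) ?_
  · have hr0 : 0 < r := (hN.1 x).trans_lt hr
    exact gauge_le_of_mem hr0.le ((hmem r hr0).2 hr.le)
  · have hpos : 0 < N x + 1 := add_pos_of_nonneg_of_pos (hN.1 x) one_pos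
    refine le_csInf ⟨N x + 1, hpos, (hmem _ hpos).2 (by linarith)⟩ fun r hr => ?_
    exact (hmem r hr.1).1 hr.2

end IsGauge

/-- The Minkowski functional of a convex neighbourhood of the origin is a gauge. -/
theorem Convex.isGauge_gauge {n : ℕ} {K : Set (EuclideanSpace ℝ (Fin n))} (hK : Convex ℝ K)
    (h0 : K ∈ 𝓝 (0 : EuclideanSpace ℝ (Fin n))) : IsGauge (gauge K) := by
  refine ⟨fun x => gauge_nonneg x, fun t ht x => gauge_smul_of_nonneg ht x, convex_univ,
    fun x _ y _ a b ha hb _ => ?_⟩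
  refine (gauge_add_le hK (absorbent_nhds_zero h0) _ _).trans_eq ?_
  rw [gauge_smul_of_nonneg ha, gauge_smul_of_nonneg hb]

/-! ### Convergence of the integrals, and the density of the decay measure on continuous rays. -/

namespace IsLC0

variable {n : ℕ} {g : EuclideanSpace ℝ (Fin n) → ℝ}

theorem ballIntegralConverges (hg : IsLC0 g) {p : ℝ} (hp : -1 < p)
    {x : EuclideanSpace ℝ (Fin n)} (hx : x ≠ 0) : BallIntegralConverges p g x := by
  have h0 := hg.origin_pos
  refine ⟨fun h => ?_, fun _ => hg.integrableOn_log_rayDecay hx, fun h => ?_⟩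
  · have hint := (hg.integrableOn_rayMoment hp h.ne' hx).const_mul (g 0)
    simp only [h.not_gt, if_false, sub_zero] at hint
    refine hint.congr (ae_of_all _ fun r => ?_)
    simp only
    field_simp
  · have hint := (hg.integrableOn_rayMoment hp h.ne hx).const_mul (g 0)
    simp only [h, if_true] at hint
    refine hint.congr (ae_of_all _ fun r => ?_)
    simp only
    field_simp

theorem continuousOn_ray_Ici (hg : IsLC0 g) {x : EuclideanSpace ℝ (Fin n)}
    (hc : ContinuousOn (fun r : ℝ => g (r • x)) (Ioi 0)) :
    ContinuousOn (fun r : ℝ => g (r • x)) (Ici 0) := by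
  intro t ht
  rcases (show 0 ≤ t from ht).eq_or_lt with rfl | ht
  · have h0 := hg.origin_pos
    obtain ⟨A, c, -, hctl⟩ := hg.exists_hasRadialControl
    have hlim : Tendsto (fun s : ℝ => g 0 * (1 - A * (s * ‖x‖))) (𝓝[≥] 0) (𝓝 (g 0)) := by
      have : ContinuousAt (fun s : ℝ => g 0 * (1 - A * (s * ‖x‖))) 0 := by fun_prop
      simpa [ContinuousAt] using this.tendsto.mono_left nhdsWithin_le_nhds
    rw [ContinuousWithinAt, zero_smul]
    refine tendsto_of_tendsto_of_tendsto_of_le_of_le' hlim tendsto_const_nhds ?_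
      (Eventually.of_forall fun s => hg.le_origin _)
    filter_upwards [self_mem_nhdsWithin] with s hs
    have h := hctl.one_sub_le (s • x)
    rw [norm_smul, Real.norm_of_nonneg hs, sub_le_comm, le_div_iff₀ h0] at h
    linarith
  · exact (hc.continuousAt (Ioi_mem_nhds ht)).continuousWithinAt

theorem neg_stieltjesFunction_eq (hg : IsLC0 g) {x : EuclideanSpace ℝ (Fin n)}
    (hc : ContinuousOn (fun r : ℝ => g (r • x)) (Ioi 0)) {t : ℝ} (ht : 0 ≤ t) :
    -(hg.monotone_neg_ray x).stieltjesFunction t = g (t • x) := by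
  refine le_antisymm (hg.neg_stieltjesFunction_le x ht) ?_
  have h : Tendsto (fun r : ℝ => g (r • x)) (𝓝[>] t) (𝓝 (g (t • x))) :=
    (hg.continuousOn_ray_Ici hc t ht).mono fun s (hs : t < s) => ht.trans hs.le
  refine le_of_tendsto h ?_
  filter_upwards [self_mem_nhdsWithin] with s hs
  exact hg.le_neg_stieltjesFunction x ht hs

theorem ray_antitone (hg : IsLC0 g) (x : EuclideanSpace ℝ (Fin n)) {s t : ℝ} (hs : 0 ≤ s)
    (hst : s ≤ t) : g (t • x) ≤ g (s • x) := by
  have := hg.monotone_neg_ray x hst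
  simp only [max_eq_left hs, max_eq_left (hs.trans hst)] at this
  exact neg_le_neg_iff.1 this

/-- Where `g (r • x) > 0`, continuity makes `r` interior to the domain of the convex function `-log
g` on the ray, which has a right derivative there. Where it vanishes, monotonicity keeps it zero to
the right. -/
theorem hasDerivWithinAt_ray (hg : IsLC0 g) {x : EuclideanSpace ℝ (Fin n)}
    (hc : ContinuousOn (fun r : ℝ => g (r • x)) (Ioi 0)) {r : ℝ} (hr : 0 < r) :
    HasDerivWithinAt (fun s : ℝ => g (s • x))
      (derivWithin (fun s : ℝ => g (s • x)) (Ioi r) r) (Ioi r) r := by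
  refine DifferentiableWithinAt.hasDerivWithinAt ?_
  rcases (hg.nonneg (r • x)).eq_or_lt with h | h
  · refine (differentiableWithinAt_const (0 : ℝ)).congr (fun s hs => ?_) h.symm
    exact le_antisymm ((hg.ray_antitone x hr.le (le_of_lt hs)).trans_eq h.symm) (hg.nonneg _)
  · have hcv := hg.convexOn_neg_log.comp_linearMap (LinearMap.toSpanSingleton ℝ _ x)
    have hev : ∀ᶠ s in 𝓝 r, 0 < g (s • x) :=
      (hc.continuousAt (Ioi_mem_nhds hr)).eventually (eventually_gt_nhds h)
    have hint : r ∈ interior ((LinearMap.toSpanSingleton ℝ _ x) ⁻¹' {x | 0 < g x}) :=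
      mem_interior_iff_mem_nhds.2 hev
    have hd := (hcv.hasDerivWithinAt_rightDeriv_of_mem_interior hint).differentiableWithinAt
    refine (hd.neg.exp).congr_of_eventuallyEq ?_ ?_
    · filter_upwards [nhdsWithin_le_nhds hev] with s hs
      simp [Real.exp_log hs]
    · simp [Real.exp_log h]

theorem derivWithin_ray_nonpos (hg : IsLC0 g) (x : EuclideanSpace ℝ (Fin n)) {r : ℝ}
    (hr : 0 < r) : derivWithin (fun s : ℝ => g (s • x)) (Ioi r) r ≤ 0 := by
  rw [derivWithin_Ioi_eq_Ici]
  refine AntitoneOn.derivWithin_nonpos fun s hs t ht hst => ?_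
  exact hg.ray_antitone x (hr.le.trans hs) hst

/-- On rays along which `g` is continuous, the decay measure has density `-∂_r g(r x)`. -/
theorem rayDecay_restrict_eq_withDensity (hg : IsLC0 g) {x : EuclideanSpace ℝ (Fin n)}
    (hx : x ≠ 0) (hc : ContinuousOn (fun r : ℝ => g (r • x)) (Ioi 0)) :
    (rayDecay g x).restrict (Ioi 0) = (volume.restrict (Ioi 0)).withDensity fun r =>
      ENNReal.ofReal (-derivWithin (fun s : ℝ => g (s • x)) (Ioi r) r) := by
  have : IsFiniteMeasure ((rayDecay g x).restrict (Ioi 0)) := ⟨by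
    rw [Measure.restrict_apply_univ, hg.rayDecay_Ioi_zero hx]
    exact ENNReal.ofReal_lt_top⟩
  refine Measure.ext_of_Ioc _ _ fun a b hab => ?_
  rw [Measure.restrict_apply measurableSet_Ioc, withDensity_apply _ measurableSet_Ioc,
    Measure.restrict_restrict measurableSet_Ioc, Ioc_inter_Ioi]
  rcases le_total b (max a 0) with h | h
  · rw [Ioc_eq_empty h.not_gt]
    simp
  have ha0 : 0 ≤ max a 0 := le_max_right _ _
  set a' := max a 0
  have hcont : ContinuousOn (fun r : ℝ => -g (r • x)) (Icc a' b) :=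
    ((hg.continuousOn_ray_Ici hc).mono fun r hr => ha0.trans hr.1).neg
  have hderiv : ∀ r ∈ Ioo a' b, HasDerivWithinAt (fun r : ℝ => -g (r • x))
      (-derivWithin (fun s : ℝ => g (s • x)) (Ioi r) r) (Ioi r) r := fun r hr =>
    (hg.hasDerivWithinAt_ray hc (ha0.trans_lt hr.1)).neg
  have hnn : ∀ r : ℝ, a' < r → 0 ≤ -derivWithin (fun s : ℝ => g (s • x)) (Ioi r) r := fun r hr =>
    neg_nonneg.2 (hg.derivWithin_ray_nonpos x (ha0.trans_lt hr))
  -- Nonnegativity of the right derivative of a continuous function yields its integrability, so no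
  -- absolute continuity has to be assumed.
  have hint := intervalIntegral.integrableOn_deriv_right_of_nonneg hcont hderiv
    fun r hr => hnn r hr.1
  have hFTC := intervalIntegral.integral_eq_sub_of_hasDeriv_right_of_le h hcont hderiv
    ((intervalIntegrable_iff_integrableOn_Ioc_of_le h).2 hint)
  rw [intervalIntegral.integral_of_le h] at hFTC
  rw [← ofReal_integral_eq_lintegral_ofReal hint, hFTC, hg.rayDecay_eq,
    StieltjesFunction.measure_Ioc, ← hg.neg_stieltjesFunction_eq hc ha0,
    ← hg.neg_stieltjesFunction_eq hc (ha0.trans h), neg_neg, neg_neg]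
  exact (ae_restrict_iff' measurableSet_Ioc).2 (ae_of_all _ fun r hr => hnn r hr.1)

theorem measurable_density_ray (x : EuclideanSpace ℝ (Fin n)) : Measurable fun r : ℝ =>
    ENNReal.ofReal (-derivWithin (fun s : ℝ => g (s • x)) (Ioi r) r) :=
  (measurable_derivWithin_Ioi _).neg.ennreal_ofReal

theorem integrableOn_deriv_mul_log (hg : IsLC0 g) {x : EuclideanSpace ℝ (Fin n)}
    (hx : x ≠ 0) (hc : ContinuousOn (fun r : ℝ => g (r • x)) (Ioi 0)) :
    IntegrableOn (fun r : ℝ => -derivWithin (fun s : ℝ => g (s • x)) (Ioi r) r * Real.log r)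
      (Ioi 0) := by
  have h := hg.integrableOn_log_rayDecay hx
  rw [IntegrableOn, hg.rayDecay_restrict_eq_withDensity hx hc,
    integrable_withDensity_iff_integrable_smul'
      (measurable_density_ray x)
      (ae_of_all _ fun _ => ENNReal.ofReal_lt_top)] at h
  refine h.congr ?_
  filter_upwards [self_mem_ae_restrict measurableSet_Ioi] with r hr
  rw [ENNReal.toReal_ofReal (neg_nonneg.2 (hg.derivWithin_ray_nonpos x hr)), smul_eq_mul]

theorem setIntegral_log_rayDecay (hg : IsLC0 g) {x : EuclideanSpace ℝ (Fin n)}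
    (hx : x ≠ 0) (hc : ContinuousOn (fun r : ℝ => g (r • x)) (Ioi 0)) :
    ∫ r in Ioi (0 : ℝ), Real.log r ∂(rayDecay g x) =
      ∫ r in Ioi (0 : ℝ), -derivWithin (fun s : ℝ => g (s • x)) (Ioi r) r * Real.log r := by
  rw [hg.rayDecay_restrict_eq_withDensity hx hc, integral_withDensity_eq_integral_toReal_smul
      (measurable_density_ray x)
      (ae_of_all _ fun _ => ENNReal.ofReal_lt_top)]
  refine setIntegral_congr_fun measurableSet_Ioi fun r hr => ?_
  rw [ENNReal.toReal_ofReal (neg_nonneg.2 (hg.derivWithin_ray_nonpos x hr)), smul_eq_mul]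

end IsLC0

theorem theorem1p6 {n : ℕ} (g : EuclideanSpace ℝ (Fin n) → ℝ) (hg : IsLC0 g) :
    -- real parameters `p > -1`
    (∀ p : ℝ, -1 < p →
      -- the defining integrals converge, and `0 < ‖x‖_{K_p(g)} < ∞` for `x ≠ 0`
      (∀ x : EuclideanSpace ℝ (Fin n), x ≠ 0 →
        BallIntegralConverges p g x ∧ 0 < ballFunctional p g x) ∧
      -- `‖·‖_{K_p(g)}` is a gauge
      IsGauge (ballFunctional p g) ∧
      -- `K_p(g)` is a convex body containing the origin in its interior, with Minkowski
      -- functional `‖·‖_{K_p(g)}`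
      IsConvexBody (ballBody p g) ∧
      (0 : EuclideanSpace ℝ (Fin n)) ∈ interior (ballBody p g) ∧
      (∀ x, gauge (ballBody p g) x = ballFunctional p g x)) ∧
    -- for `p = 0`, on rays where `g` is continuous the measure `-d_r g(rx)` is `-∂_r g(rx) dr`,
    -- with the one-sided derivative
    (∀ x : EuclideanSpace ℝ (Fin n), x ≠ 0 →
      ContinuousOn (fun r : ℝ => g (r • x)) (Set.Ioi 0) →
      IntegrableOn
        (fun r : ℝ => -derivWithin (fun s : ℝ => g (s • x)) (Set.Ioi r) r * Real.log r)
        (Set.Ioi 0) ∧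
      ballFunctional 0 g x = Real.exp (-(1 / g 0) *
        ∫ r in Set.Ioi (0 : ℝ),
          -derivWithin (fun s : ℝ => g (s • x)) (Set.Ioi r) r * Real.log r)) ∧
    -- `p = ∞`, where `K_∞(g) = supp g` is convex but possibly unbounded
    (IsClosed (supp g) ∧ Convex ℝ (supp g) ∧ IsGauge (gauge (supp g))) := by
  refine ⟨fun p hp => ?_, fun x hx hc => ⟨hg.integrableOn_deriv_mul_log hx hc, ?_⟩,
    isClosed_closure, hg.convex_pos.closure,
    hg.convex_pos.closure.isGauge_gauge (mem_interior_iff_mem_nhds.1 hg.origin_mem)⟩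
  · have hG := hg.isGauge_ballFunctional hp
    exact ⟨fun x hx => ⟨hg.ballIntegralConverges hp hx, hg.ballFunctional_pos hp hx⟩, hG,
      hG.isConvexBody_sublevel fun x hx => hg.ballFunctional_pos hp hx,
      hG.zero_mem_interior_sublevel, hG.gauge_sublevel⟩
  · rw [ballFunctional, if_neg hx, if_neg (lt_irrefl _), if_pos rfl,
      hg.setIntegral_log_rayDecay hx hc]
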